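/- An \emph{abelian processor} with input alphabet $I$ and state space $Q$ is a family of commuting maps $t_a:Q\to Q$ ($a\in I$); its \emph{transition monoid} is the submonoid of $\mathrm{End}(Q)$ generated by the $t_a$. Let $G=(V,E)$ be a finite directed graph (loops and multiple edges allowed) and let $A_v$ ($v\in V$) be finite alphabets, $A=\bigsqcup_v A_v$. A \emph{finite abelian network} $\mathcal N$ on $G$ with total alphabet $A$ consists of, for each $v\in V$, an abelian processor with input alphabet $A_v$ and finite state space $Q_v$, together with message functions assigning to each letter $a\in A_v$, outgoing edge $(v,u)$ and state $q \in Q_v$ a word in $A_u^*$ (sent along the edge when $a$ is processed in state $q$), such that two input words that are equal up to permutation, read from the same state, produce on each edge output words that are equal up to permutation. A total state $\mathbf x.\mathbf q$ consists of a vector $\mathbf x\in\mathbb Z^A$ of waiting letters and a state $\mathbf q\in Q=\prod_v Q_v$; processing a letter $a\in A_v$ removes one $a$, applies $t_a$ to $\mathbf q_v$ and adds the letters sent. An execution is \emph{legal} if each letter is present when it is processed, and \emph{complete} if no letters remain at its end. $\mathcal N$ \emph{halts on all inputs} if every $\mathbf x.\mathbf q$ with $\mathbf x\in\mathbb N^A$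 has a complete legal execution. In that case the final state is independent of the execution; let $\tau_a(\mathbf q)$ be the final state for the input $1_a.\mathbf q$, let $M\subset \mathrm{End}(Q)$ be the (finite commutative) monoid generated by the $\tau_a$, and let $e$ be its minimal idempotent, i.e. the product of all its idempotents. The \emph{critical group} $\mathrm{Crit}\,\mathcal N$ is the finite abelian group $eM$. $\mathcal N$ is \emph{irreducible} if for each $v$ the transition monoid $M_v$ of the processor at $v$ acts irreducibly on $Q_v$: $Q_v\neq\emptyset$, and for all $q,q'\in Q_v$ there are $m,m'\in M_v$ with $mq=m'q'$. Let $e_v$ be the minimal idempotent of $M_v$. Each $t_a$, $a\in A_v$, permutes $e_vQ_v$, so $\mathbb Z^{A_v}$ acts on $e_vQ_v$; let $K_v$ be the kernel of this action. The \emph{total kernel} is $K=\prod_v K_v\subset\mathbb Z^A$. If $\mathbf k\in K\cap\mathbb N^A$, then processing $\mathbf k_a$ letters $a$ for each $a\in A$, starting from a locally recurrent state $\mathbf q\in\prod_v e_vQ_v$, returns the network to the state $\mathbf q$; let $P(\mathbf k)\in\mathbb N^A$ be the vector of letters sent. For irreducible $\mathcal N$ this does not depend on $\mathbf q$, and $P$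 extends uniquely to a homomorphism $P:K\to\mathbb Z^A$, the \emph{production map}. Irreducible abelian networks on the same graph with the same total alphabet are \emph{homotopic} if they have the same total kernel and the same production map. \textbf{Corollary.} (1) If $\mathcal N$ and $\mathcal N'$ are homotopic finite irreducible abelian networks that halt on all inputs, then $\mathrm{Crit}\,\mathcal N\simeq\mathrm{Crit}\,\mathcal N'$. (2) Let $s\in V$ be a vertex such that from every other vertex there is a directed path to $s$, and let $d_v$ be the outdegree of $v$. Let $\mathtt{Sand}(G,s)$ and $\mathtt{Rotor}(G,s)$ be the networks with $A_v=\{v\}$ for all $v$ in which $s$ has one state and never sends a message, and each $v\ne s$ has state space $\mathbb Z/d_v\mathbb Z$ and transition $q\mapsto q+1$; in $\mathtt{Sand}(G,s)$ the processor at $v\neq s$ sends one letter along each outgoing edge whenever it passes from state $d_v-1$ to state $0$, and in $\mathtt{Rotor}(G,s)$, for a fixed ordering $e_1,\dots,e_{d_v}$ of the outgoing edges of each $v$, it sends exactly one letter, along $e_{q+1}$, whenever it passes from state $q\in\{0,\dots,d_v-1\}$ to $q+1$ modulo $d_v$. Then $\mathtt{Rotor}(G,s)$ and $\mathtt{Sand}(G,s)$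 are homotopic (in particular irreducible), both halt on all inputs, and $\mathrm{Crit}\,\mathtt{Rotor}(G,s)\simeq\mathrm{Crit}\,\mathtt{Sand}(G,s)$. -/

import Mathlib

/-! ### Finite commutative monoids: minimal idempotent, the group `eM`, its action on `eX` -/

section MonoidTheory

variable (M : Type*) [CommMonoid M]

/-- The minimal idempotent `e`: the product of all idempotents of a finite commutative monoid. -/
noncomputable def minIdem : M := ∏ᶠ f : {f : M // IsIdempotentElem f}, (f : M)

variable {M}

theorem exists_idempotent_pow [Finite M] (m : M) : ∃ j : ℕ, IsIdempotentElem (m ^ (j + 1)) := by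
  obtain ⟨a, b, hab, h⟩ := Finite.exists_ne_map_eq_of_infinite (fun n : ℕ => m ^ n)
  wlog hlt : a < b generalizing a b
  · exact this b a hab.symm h.symm (by omega)
  have h : m ^ a = m ^ b := h
  have per : ∀ n k : ℕ, a ≤ n → m ^ (n + k * (b - a)) = m ^ n := by
    intro n k hn
    induction k with
    | zero => simp
    | succ k ih =>
      rw [← ih]
      have e1 : n + (k + 1) * (b - a) = b + (n - a + k * (b - a)) := by
        rw [Nat.add_mul]; omega
      have e2 : n + k * (b - a) = a + (n - a + k * (b - a)) := by omega
      rw [e1, pow_add, ← h, ← pow_add, ← e2]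
  have hpos : 0 < (a + 1) * (b - a) := by
    have : 0 < b - a := by omega
    positivity
  refine ⟨(a + 1) * (b - a) - 1, ?_⟩
  have hj : (a + 1) * (b - a) - 1 + 1 = (a + 1) * (b - a) := by omega
  rw [hj, IsIdempotentElem, ← pow_add]
  refine per _ _ ?_
  have : 1 ≤ b - a := by omega
  nlinarith

theorem minIdem_idem [Finite M] : IsIdempotentElem (minIdem M) := by
  classical
  have := Fintype.ofFinite {f : M // IsIdempotentElem f}
  rw [minIdem, finprod_eq_prod_of_fintype, IsIdempotentElem, ← Finset.prod_mul_distrib]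
  exact Finset.prod_congr rfl fun f _ => f.2

theorem dvd_minIdem [Finite M] (m : M) : m ∣ minIdem M := by
  obtain ⟨j, hj⟩ := exists_idempotent_pow m
  have h1 : m ∣ m ^ (j + 1) := dvd_pow_self m (by omega)
  refine h1.trans ?_
  exact finprod_mem_dvd (f := fun f : {f : M // IsIdempotentElem f} => (f : M))
    ⟨m ^ (j + 1), hj⟩ (Set.toFinite _)

variable (M) in
/-- The set `eM`, where `e` is the minimal idempotent of `M`. -/
def MinIdeal : Type _ := {m : M // ∃ n, m = minIdem M * n}

namespace MinIdeal

@[ext]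
theorem ext' {g h : MinIdeal M} (hgh : g.1 = h.1) : g = h := Subtype.ext hgh

/-- The map `m ↦ em` from `M` to `eM`. -/
noncomputable def of (m : M) : MinIdeal M := ⟨minIdem M * m, m, rfl⟩

theorem minIdem_mul_val [Finite M] (g : MinIdeal M) : minIdem M * g.1 = g.1 := by
  obtain ⟨_, n, rfl⟩ := g
  rw [← mul_assoc, minIdem_idem.eq]

/-- `eM` is an abelian group under the multiplication of `M`, with identity element `e`. -/
noncomputable instance [Finite M] : CommGroup (MinIdeal M) where
  mul g h := ⟨g.1 * h.1, g.1 * h.1, by rw [← mul_assoc, minIdem_mul_val]⟩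
  one := ⟨minIdem M, 1, by simp⟩
  inv g := of (dvd_minIdem g.1).choose
  mul_assoc a b c := Subtype.ext (mul_assoc _ _ _)
  one_mul a := Subtype.ext (minIdem_mul_val a)
  mul_one a := Subtype.ext ((mul_comm _ _).trans (minIdem_mul_val a))
  mul_comm a b := Subtype.ext (mul_comm _ _)
  inv_mul_cancel a := Subtype.ext (by
    change minIdem M * (dvd_minIdem a.1).choose * a.1 = minIdem M
    rw [mul_assoc, mul_comm _ a.1, ← (dvd_minIdem a.1).choose_spec, minIdem_idem.eq])

theorem val_mul [Finite M] (g h : MinIdeal M) : (g * h).1 = g.1 * h.1 := rfl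

theorem val_one [Finite M] : (1 : MinIdeal M).1 = minIdem M := rfl

instance [Finite M] : Finite (MinIdeal M) := Subtype.finite

end MinIdeal

variable (M) in
/-- The set `eX` of recurrent elements of a monoid action of `M` on `X`. -/
def RecElts (X : Type*) [MulAction M X] : Type _ := {x : X // ∃ y, x = minIdem M • y}

/-- The action of the group `eM` on `eX` obtained by restricting the action of `M` on `X`. -/
noncomputable instance {X : Type*} [MulAction M X] [Finite M] :
    MulAction (MinIdeal M) (RecElts M X) where
  smul g x := ⟨g.1 • x.1, g.1 • x.1, by rw [smul_smul, MinIdeal.minIdem_mul_val]⟩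
  one_smul := by
    rintro ⟨_, y, rfl⟩
    exact Subtype.ext (by
      change minIdem M • minIdem M • y = minIdem M • y
      rw [smul_smul, minIdem_idem.eq])
  mul_smul g h x := Subtype.ext (mul_smul g.1 h.1 x.1)

theorem RecElts.val_smul {X : Type*} [MulAction M X] [Finite M] (g : MinIdeal M)
    (x : RecElts M X) : (g • x).1 = g.1 • x.1 := rfl

theorem RecElts.of_smul {X : Type*} [MulAction M X] [Finite M] (m : M)
    (x : RecElts M X) : (MinIdeal.of m • x).1 = m • x.1 := by
  obtain ⟨_, y, rfl⟩ := x
  change (minIdem M * m) • minIdem M • y = m • minIdem M • y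
  rw [smul_smul, smul_smul, mul_comm, ← mul_assoc, minIdem_idem.eq, mul_comm]

variable (M) in
/-- A monoid action is irreducible if the equivalence relation
`x ∼ x' ↔ ∃ m m', m x = m' x'` has exactly one equivalence class. -/
def IsIrreducibleAction (X : Type*) [MulAction M X] : Prop :=
  Nonempty X ∧ ∀ x x' : X, ∃ m m' : M, m • x = m' • x'

end MonoidTheory

/-! ### Abelian processors -/

/-- An abelian processor with input alphabet `I` and state space `Q`: commuting transition maps. -/
structure AbelianProcessor (I Q : Type*) where
  /-- the state transition maps -/
  t : I → Function.End Q
  t_comm : ∀ a b, t a * t b = t b * t a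

namespace AbelianProcessor

variable {I Q : Type*} (P : AbelianProcessor I Q)

/-- The submonoid of `End Q` generated by the transition maps. -/
def transitionMonoid : Submonoid (Function.End Q) := Submonoid.closure (Set.range P.t)

instance : CommMonoid P.transitionMonoid :=
  { (inferInstance : Monoid P.transitionMonoid) with
    mul_comm := (Submonoid.isMulCommutative_closure (s := Set.range P.t) _ (by
      rintro _ ⟨a, rfl⟩ _ ⟨b, rfl⟩
      exact P.t_comm a b)).is_comm.comm }

instance [Finite Q] : Finite P.transitionMonoid :=
  have : Finite (Function.End Q) := inferInstanceAs (Finite (Q → Q))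
  Subtype.finite

/-- A transition map as an element of the transition monoid. -/
def gen (a : I) : P.transitionMonoid := ⟨P.t a, Submonoid.subset_closure ⟨a, rfl⟩⟩

/-- The action of the transition monoid on the state space is irreducible. -/
def Irreducible : Prop := IsIrreducibleAction P.transitionMonoid Q

/-- The group `eM` of the transition monoid `M`. -/
abbrev Grp : Type _ := MinIdeal P.transitionMonoid

/-- The recurrent states, `eQ`. -/
abbrev Rec : Type _ := RecElts P.transitionMonoid Q

/-- The homomorphism from `ℤ ^ I` to the group `eM` that sends the basis vector `1_a` to `e t_a`;
through it `ℤ ^ I` acts on `eQ`, the vector `1_a` acting by the restriction of `t_a`. -/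
noncomputable def grpElt [Finite Q] [Fintype I] (x : I → ℤ) : P.Grp :=
  ∏ a, (MinIdeal.of (P.gen a)) ^ x a

theorem grpElt_add [Finite Q] [Fintype I] (x y : I → ℤ) :
    P.grpElt (x + y) = P.grpElt x * P.grpElt y := by
  simp [grpElt, zpow_add, Finset.prod_mul_distrib]

theorem grpElt_zero [Finite Q] [Fintype I] : P.grpElt 0 = 1 := by
  simp [grpElt]

theorem grpElt_single [Finite Q] [Fintype I] [DecidableEq I] (a : I) :
    P.grpElt (Pi.single a 1) = MinIdeal.of (P.gen a) := by
  rw [grpElt, Finset.prod_eq_single a]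
  · simp
  · intro b _ hb
    simp [hb]
  · simp

/-- The kernel of the action of `ℤ ^ I` on `eQ`. -/
noncomputable def kernel [Finite Q] [Fintype I] : AddSubgroup (I → ℤ) where
  carrier := {x | ∀ q : P.Rec, P.grpElt x • q = q}
  zero_mem' q := by rw [grpElt_zero, one_smul]
  add_mem' {x y} hx hy q := by rw [grpElt_add, mul_smul, hy, hx]
  neg_mem' {x} hx q := by
    conv_lhs => rw [← hx q]
    rw [smul_smul, ← grpElt_add, neg_add_cancel, grpElt_zero, one_smul]

end AbelianProcessor

/-- The word output by an automaton with transition maps `t` and message passing functions `o`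
when it reads an input word starting from a given state. -/
def outputWord {I Q B : Type*} (t : I → Function.End Q) (o : I → Q → List B) :
    List I → Q → List B
  | [], _ => []
  | a :: w, q => o a q ++ outputWord t o w (t a q)

/-- An abelian processor with input alphabet `I`, state space `Q` and output alphabets `B u`. -/
structure OutputProcessor (I Q : Type*) {U : Type*} (B : U → Type*) extends
    AbelianProcessor I Q where
  /-- the message passing functions -/
  o : I → (u : U) → Q → List (B u)
  /-- input words equal up to permutation give output words equal up to permutation -/
  o_perm : ∀ w w' : List I, w.Perm w' → ∀ (u : U) (q : Q),
    (outputWord t (fun a => o a u) w q).Perm (outputWord t (fun a => o a u) w' q)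

/-! ### Abelian networks -/

universe uV uE uA uQ uQ'

/-- An abelian network on the directed graph (quiver; loops and multiple edges are allowed) with
vertex set `V`, where the processor at `v` has input alphabet `A v` and, for each outgoing edge
of `v`, the input alphabet of the endpoint of that edge as output alphabet. -/
structure AbelianNetwork (V : Type uV) [Quiver.{uE + 1} V] (A : V → Type uA) where
  /-- the state spaces -/
  Q : V → Type uQ
  /-- the processors -/
  proc : ∀ v, OutputProcessor (A v) (Q v) (fun e : Quiver.Star v => A e.1)

/-- The total alphabet, the disjoint union of the alphabets `A v`. -/
abbrev Letter {V : Type*} (A : V → Type*) : Type _ := Σ v, A v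

namespace AbelianNetwork

variable {V : Type uV} [Quiver.{uE + 1} V] {A : V → Type uA}

/-- States of the network: a state of each processor. -/
abbrev State (N : AbelianNetwork.{uV, uE, uA, uQ} V A) : Type _ := ∀ v, N.Q v

/-- Total states `x.q`: numbers of waiting letters (possibly negative), and a state. -/
abbrev TotalState (N : AbelianNetwork.{uV, uE, uA, uQ} V A) : Type _ := (Letter A → ℤ) × N.State

variable (N : AbelianNetwork.{uV, uE, uA, uQ} V A)

variable [∀ v : V, Fintype (Quiver.Star v)]

open Classical in
/-- The number of letters `b` sent, along all outgoing edges, when the processor to which the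
letter `a` belongs processes `a` in state `q`. -/
noncomputable def sent (a : Letter A) (q : N.Q a.1) (b : Letter A) : ℤ :=
  ∑ e : Quiver.Star a.1,
    ((((N.proc a.1).o a.2 e q).map (Sigma.mk e.1 : A e.1 → Letter A)).count b : ℤ)

open Classical in
/-- Processing one letter `a`: it is removed, the processor to which it belongs changes state,
and the messages are sent. -/
noncomputable def step (a : Letter A) (s : N.TotalState) : N.TotalState :=
  (s.1 - Pi.single a 1 + N.sent a (s.2 a.1),
    Function.update s.2 a.1 ((N.proc a.1).t a.2 (s.2 a.1)))

/-- The result `π_w(x.q)` of executing the word `w`. -/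
noncomputable def exec : List (Letter A) → N.TotalState → N.TotalState
  | [], s => s
  | a :: w, s => exec w (N.step a s)

/-- The word `w` is a legal execution: each letter is present when it is processed. -/
def IsLegal : List (Letter A) → N.TotalState → Prop
  | [], _ => True
  | a :: w, s => 1 ≤ s.1 a ∧ IsLegal w (N.step a s)

/-- The word `w` is a complete execution: no letters remain. -/
def IsComplete (w : List (Letter A)) (s : N.TotalState) : Prop := (N.exec w s).1 ≤ 0

/-- Every `x.q` with `x ≥ 0` has a complete legal execution. -/
def HaltsOnAllInputs : Prop :=
  ∀ (x : Letter A → ℕ) (q : N.State),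
    ∃ w, N.IsLegal w (fun a => (x a : ℤ), q) ∧ N.IsComplete w (fun a => (x a : ℤ), q)

/-! The order of execution does not matter. -/

theorem sent_nonneg (a : Letter A) (q : N.Q a.1) : 0 ≤ N.sent a q := fun _ =>
  Finset.sum_nonneg fun _ _ => Int.natCast_nonneg _

theorem sent_comm (v : V) (a b : A v) (q : N.Q v) :
    N.sent ⟨v, a⟩ q + N.sent ⟨v, b⟩ ((N.proc v).t a q) =
      N.sent ⟨v, b⟩ q + N.sent ⟨v, a⟩ ((N.proc v).t b q) := by
  classical
  funext c
  simp only [sent, Pi.add_apply, ← Finset.sum_add_distrib]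
  refine Finset.sum_congr rfl fun e _ => ?_
  have h := (N.proc v).o_perm [a, b] [b, a] (List.Perm.swap _ _ _) e q
  simp only [outputWord, List.append_nil] at h
  have := (h.map (Sigma.mk e.1 : A e.1 → Letter A)).count_eq c
  simp only [List.map_append, List.count_append] at this
  exact_mod_cast this

theorem step_comm (a b : Letter A) (s : N.TotalState) :
    N.step a (N.step b s) = N.step b (N.step a s) := by
  classical
  obtain ⟨x, q⟩ := s
  obtain ⟨v, a⟩ := a
  obtain ⟨u, b⟩ := b
  by_cases h : u = v
  · subst h
    refine Prod.ext ?_ ?_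
    · have := N.sent_comm u a b (q u)
      simp only [step, Function.update_self]
      calc _ = x - Pi.single ⟨u, b⟩ 1 - Pi.single ⟨u, a⟩ 1 +
            (N.sent ⟨u, b⟩ (q u) + N.sent ⟨u, a⟩ ((N.proc u).t b (q u))) := by abel
        _ = _ := by rw [← this]; abel
    · simp only [step, Function.update_self, Function.update_idem]
      congr 1
      exact congrFun ((N.proc u).t_comm a b) (q u)
  · refine Prod.ext ?_ ?_
    · simp only [step, Function.update_of_ne h, Function.update_of_ne (Ne.symm h)]
      abel
    · simp only [step, Function.update_of_ne h, Function.update_of_ne (Ne.symm h)]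
      exact Function.update_comm h _ _ _

theorem exec_perm {w w' : List (Letter A)} (h : w.Perm w') (s : N.TotalState) :
    N.exec w s = N.exec w' s := by
  induction h generalizing s with
  | nil => rfl
  | cons a _ ih => exact ih _
  | swap a b l => simp only [exec, step_comm]
  | trans _ _ ih₁ ih₂ => exact (ih₁ s).trans (ih₂ s)

theorem exec_append (w w' : List (Letter A)) (s : N.TotalState) :
    N.exec (w ++ w') s = N.exec w' (N.exec w s) := by
  induction w generalizing s with
  | nil => rfl
  | cons a w ih => exact ih _

theorem isLegal_append (w w' : List (Letter A)) (s : N.TotalState) :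
    N.IsLegal (w ++ w') s ↔ N.IsLegal w s ∧ N.IsLegal w' (N.exec w s) := by
  induction w generalizing s with
  | nil => simp [IsLegal, exec]
  | cons a w ih => simp only [List.cons_append, IsLegal, exec, ih, and_assoc]

theorem exec_shift (w : List (Letter A)) (x y : Letter A → ℤ) (q : N.State) :
    N.exec w (x + y, q) = ((N.exec w (x, q)).1 + y, (N.exec w (x, q)).2) := by
  induction w generalizing x q with
  | nil => rfl
  | cons a w ih =>
    simp only [exec, step]
    rw [← ih]
    congr 2
    abel

theorem IsLegal.shift {w : List (Letter A)} {x y : Letter A → ℤ} {q : N.State} (hy : 0 ≤ y)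
    (h : N.IsLegal w (x, q)) : N.IsLegal w (x + y, q) := by
  induction w generalizing x q with
  | nil => trivial
  | cons a w ih =>
    refine ⟨?_, ?_⟩
    · have h1 : 1 ≤ x a := h.1
      have h2 := hy a
      simp only [Pi.zero_apply] at h2
      change 1 ≤ x a + y a
      omega
    · have := ih h.2
      simp only [step] at this ⊢
      convert this using 2
      abel

theorem exec_nonneg {w : List (Letter A)} {s : N.TotalState} (hs : 0 ≤ s.1)
    (h : N.IsLegal w s) : 0 ≤ (N.exec w s).1 := by
  classical
  induction w generalizing s with
  | nil => exact hs
  | cons a w ih =>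
    refine ih ?_ h.2
    intro b
    have h1 := N.sent_nonneg a (s.2 a.1) b
    have h2 := hs b
    have h3 := h.1
    simp only [step, Pi.add_apply, Pi.sub_apply, Pi.zero_apply, Pi.single_apply] at *
    split_ifs with hb
    · subst hb; omega
    · omega

theorem le_exec_of_notMem {w : List (Letter A)} {a : Letter A} (ha : a ∉ w) (s : N.TotalState) :
    s.1 a ≤ (N.exec w s).1 a := by
  classical
  induction w generalizing s with
  | nil => exact le_rfl
  | cons b w ih =>
    simp only [List.mem_cons, not_or] at ha
    refine le_trans ?_ (ih ha.2 _)
    have h1 := N.sent_nonneg b (s.2 b.1) a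
    simp only [step, Pi.add_apply, Pi.sub_apply, Pi.zero_apply, Pi.single_apply, if_neg ha.1] at *
    omega

/-- The least action principle. -/
theorem IsLegal.subperm {w w' : List (Letter A)} {s : N.TotalState} (h : N.IsLegal w s)
    (h' : N.IsComplete w' s) : w.Subperm w' := by
  classical
  induction w generalizing w' s with
  | nil => exact List.nil_subperm
  | cons a w ih =>
    have ha : a ∈ w' := by
      by_contra hn
      have h1 := N.le_exec_of_notMem hn s
      have h2 := h' a
      have h3 := h.1
      simp only [Pi.zero_apply] at h2
      omega
    have hp := List.perm_cons_erase ha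
    have : N.IsComplete (w'.erase a) (N.step a s) := by
      have h2 : N.IsComplete w' s := h'
      rw [IsComplete, N.exec_perm hp] at h2
      exact h2
    exact (List.subperm_cons a |>.2 (ih h.2 this)).trans hp.symm.subperm

theorem exec_unique {w w' : List (Letter A)} {s : N.TotalState} (h : N.IsLegal w s)
    (hc : N.IsComplete w s) (h' : N.IsLegal w' s) (hc' : N.IsComplete w' s) :
    N.exec w s = N.exec w' s :=
  N.exec_perm ((h.subperm N hc').antisymm (h'.subperm N hc)) s

/-! ### The global action and the critical group -/

variable {N}

/-- The global action `x ▷▷ q`: the final state of a complete legal execution of `x.q`. -/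
noncomputable def globalAct (h : N.HaltsOnAllInputs) (x : Letter A → ℕ) (q : N.State) : N.State :=
  (N.exec (h x q).choose (fun a => (x a : ℤ), q)).2

theorem globalAct_eq (h : N.HaltsOnAllInputs) {x : Letter A → ℕ} {q : N.State}
    {w : List (Letter A)} (hl : N.IsLegal w (fun a => (x a : ℤ), q))
    (hc : N.IsComplete w (fun a => (x a : ℤ), q)) :
    globalAct h x q = (N.exec w (fun a => (x a : ℤ), q)).2 := by
  rw [globalAct, N.exec_unique (h x q).choose_spec.1 (h x q).choose_spec.2 hl hc]

theorem globalAct_add (h : N.HaltsOnAllInputs) (x y : Letter A → ℕ) (q : N.State) :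
    globalAct h (x + y) q = globalAct h y (globalAct h x q) := by
  obtain ⟨w, hl, hc⟩ := h x q
  obtain ⟨w', hl', hc'⟩ := h y (globalAct h x q)
  have e1 : (fun a => (((x + y) a : ℕ) : ℤ)) = (fun a => (x a : ℤ)) + fun a => (y a : ℤ) := by
    funext a; simp
  have e2 : (N.exec w (fun a => (x a : ℤ), q)).1 = 0 :=
    le_antisymm hc (N.exec_nonneg (fun a => Int.natCast_nonneg _) hl)
  have e3 : N.exec w (fun a => (((x + y) a : ℕ) : ℤ), q) =
      (fun a => (y a : ℤ), globalAct h x q) := by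
    rw [e1, exec_shift, e2, zero_add, globalAct_eq h hl hc]
  have hl2 : N.IsLegal (w ++ w') (fun a => (((x + y) a : ℕ) : ℤ), q) := by
    rw [isLegal_append, e3]
    refine ⟨?_, hl'⟩
    rw [e1]
    exact hl.shift N (fun a => Int.natCast_nonneg _)
  have hc2 : N.IsComplete (w ++ w') (fun a => (((x + y) a : ℕ) : ℤ), q) := by
    rw [IsComplete, exec_append, e3]
    exact hc'
  rw [globalAct_eq h hl2 hc2, exec_append, e3, globalAct_eq h hl' hc']

open Classical in
/-- A network that halts on all inputs, viewed as a single abelian processor whose input alphabet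
is the total alphabet: the transition maps are `τ_a(q) = 1_a ▷▷ q`. -/
noncomputable def globalProcessor (h : N.HaltsOnAllInputs) :
    AbelianProcessor (Letter A) N.State where
  t a := fun q => globalAct h (Pi.single a 1) q
  t_comm a b := by
    funext q
    change globalAct h _ (globalAct h _ q) = globalAct h _ (globalAct h _ q)
    rw [← globalAct_add, ← globalAct_add, add_comm]

/-- The critical group `eM`, where `M` is the global monoid, generated by the maps `τ_a`, and `e`
is its minimal idempotent; for a finite network it is a finite abelian group. -/
abbrev Crit (h : N.HaltsOnAllInputs) : Type _ := (globalProcessor h).Grp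

/-! ### Irreducibility, total kernel, production map, homotopy -/

variable (N)

/-- Each processor is irreducible. -/
def Irreducible : Prop := ∀ v, (N.proc v).toAbelianProcessor.Irreducible

/-- Locally recurrent states: `q v ∈ e_v Q_v` for all `v`, where `e_v` is the minimal idempotent
of the transition monoid at `v`. -/
abbrev LocRec : Type _ := ∀ v, (N.proc v).toAbelianProcessor.Rec

variable {N} in
/-- A locally recurrent state as a state of the network. -/
def LocRec.state (p : N.LocRec) : N.State := fun v => (p v).1

/-- The total kernel `K = ∏ K_v`, where `K_v` is the kernel of the action of `ℤ ^ A_v` on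
`e_v Q_v`, as a subgroup of `ℤ ^ A` for the total alphabet `A`. -/
noncomputable def totalKernel [∀ v, Finite (N.Q v)] [∀ v, Fintype (A v)] :
    AddSubgroup (Letter A → ℤ) where
  carrier := {x | ∀ v, (fun a => x ⟨v, a⟩) ∈ (N.proc v).toAbelianProcessor.kernel}
  zero_mem' _ := AddSubgroup.zero_mem _
  add_mem' hx hy v := AddSubgroup.add_mem _ (hx v) (hy v)
  neg_mem' hx v := AddSubgroup.neg_mem _ (hx v)

section LocalAction

variable [Fintype V] [∀ v, Fintype (A v)]

/-- A word in which each letter `a` occurs `x a` times. -/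
noncomputable def wordOf (x : Letter A → ℕ) : List (Letter A) :=
  (∑ a, Multiset.replicate (x a) a).toList

open Classical in
theorem count_wordOf (x : Letter A → ℕ) (a : Letter A) : (wordOf x).count a = x a := by
  rw [← Multiset.coe_count, wordOf, Multiset.coe_toList, Multiset.count_sum']
  simp [Multiset.count_replicate]

/-- The local action `x ▷ (y.q) = π_x((x + y).q)`. -/
noncomputable def localAct (x : Letter A → ℕ) (s : N.TotalState) : N.TotalState :=
  N.exec (wordOf x) ((fun a => (x a : ℤ)) + s.1, s.2)

open Classical in
theorem wordOf_add (x y : Letter A → ℕ) : (wordOf (x + y)).Perm (wordOf x ++ wordOf y) := by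
  rw [List.perm_iff_count]
  intro a
  rw [List.count_append, count_wordOf, count_wordOf, count_wordOf, Pi.add_apply]

variable [∀ v, Finite (N.Q v)]

open Classical in
theorem exec_state (w : List (Letter A)) (x : Letter A → ℤ) (p : N.LocRec) :
    (N.exec w (x, p.state)).2 =
      LocRec.state (N := N) (fun v =>
        (N.proc v).toAbelianProcessor.grpElt (fun a => (w.count ⟨v, a⟩ : ℤ)) • p v) := by
  induction w generalizing x p with
  | nil =>
    have : ∀ v, (fun a : A v => (([] : List (Letter A)).count ⟨v, a⟩ : ℤ)) = 0 := by
      intro v; funext a; simp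
    simp only [exec, this, AbelianProcessor.grpElt_zero, one_smul]
  | cons b w ih =>
    obtain ⟨u, b⟩ := b
    have hs : (N.step ⟨u, b⟩ (x, p.state)).2 = LocRec.state (N := N)
        (Function.update p u (MinIdeal.of ((N.proc u).toAbelianProcessor.gen b) • p u)) := by
      funext v
      by_cases h : v = u
      · subst h
        simp only [step, LocRec.state, Function.update_self, RecElts.of_smul]
        rfl
      · simp only [step, LocRec.state, Function.update_of_ne h]
    have he : N.step ⟨u, b⟩ (x, p.state) = ((N.step ⟨u, b⟩ (x, p.state)).1, LocRec.state (N := N)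
        (Function.update p u (MinIdeal.of ((N.proc u).toAbelianProcessor.gen b) • p u))) :=
      Prod.ext rfl hs
    rw [exec, he, ih]
    congr 1
    funext v
    by_cases h : v = u
    · subst h
      rw [Function.update_self, smul_smul, ← AbelianProcessor.grpElt_single,
        ← AbelianProcessor.grpElt_add]
      congr 2
      funext a
      by_cases hab : a = b
      · subst hab; simp
      · have : (⟨v, b⟩ : Letter A) ≠ ⟨v, a⟩ := by
          intro h; exact hab (by simpa using h.symm)
        simp [hab, List.count_cons_of_ne this]
    · rw [Function.update_of_ne h]
      congr 2
      funext a
      have : (⟨u, b⟩ : Letter A) ≠ ⟨v, a⟩ := by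
        intro h'; exact h (congrArg Sigma.fst h').symm
      rw [List.count_cons_of_ne this]

/-- The vector `P_p(k)`, the letters that are sent when the locally recurrent state `p` processes
`k a` letters `a` for each `a`; it is used for `k ∈ K`, so that `k ▷ p = P_p(k).p`. -/
noncomputable def productionNat (p : N.LocRec) (k : Letter A → ℕ) : Letter A → ℤ :=
  (N.localAct k (0, p.state)).1

theorem localAct_eq (p : N.LocRec) {k : Letter A → ℕ} (hk : (fun a => (k a : ℤ)) ∈ N.totalKernel) :
    N.localAct k (0, p.state) = (N.productionNat p k, p.state) := by
  classical
  refine Prod.ext rfl ?_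
  rw [localAct, exec_state]
  congr 1
  funext v
  simp only [count_wordOf]
  exact hk v (p v)

theorem productionNat_add (p : N.LocRec) {k l : Letter A → ℕ}
    (hk : (fun a => (k a : ℤ)) ∈ N.totalKernel) :
    N.productionNat p (k + l) = N.productionNat p k + N.productionNat p l := by
  have h1 := N.localAct_eq p hk
  have e1 : (fun a => (((k + l) a : ℕ) : ℤ)) + 0 = ((fun a => (k a : ℤ)) + 0) +
      ((fun a => (l a : ℤ)) + 0) := by
    funext a; simp
  rw [productionNat, localAct, N.exec_perm (wordOf_add k l), exec_append]
  simp only [localAct] at h1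
  dsimp only
  rw [e1, exec_shift, h1]
  dsimp only
  rw [add_comm, exec_shift, add_comm]
  rfl

/-- A nonnegative vector of the total kernel that is at least `-k`. -/
noncomputable def kernelShift (k : Letter A → ℤ) : Letter A → ℕ :=
  fun a => Nat.card (N.proc a.1).toAbelianProcessor.Grp * (k a).natAbs

theorem kernelShift_mem (k : Letter A → ℤ) :
    (fun a => (N.kernelShift k a : ℤ)) ∈ N.totalKernel := by
  intro v q
  have : (N.proc v).toAbelianProcessor.grpElt (fun a => (N.kernelShift k ⟨v, a⟩ : ℤ)) = 1 := by
    refine Finset.prod_eq_one fun a _ => ?_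
    rw [zpow_natCast]
    change _ ^ (Nat.card (N.proc v).toAbelianProcessor.Grp * _) = 1
    rw [pow_mul, pow_card_eq_one', one_pow]
  rw [this, one_smul]

theorem add_kernelShift_nonneg (k : Letter A → ℤ) (a : Letter A) :
    0 ≤ k a + N.kernelShift k a := by
  have h1 : 1 ≤ Nat.card (N.proc a.1).toAbelianProcessor.Grp := Nat.card_pos
  have h2 : (k a).natAbs ≤ N.kernelShift k a := Nat.le_mul_of_pos_left _ h1
  omega

theorem toNat_kernelShift_mem {k : Letter A → ℤ} (hk : k ∈ N.totalKernel) :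
    (fun a => ((k a + N.kernelShift k a).toNat : ℤ)) ∈ N.totalKernel := by
  have : (fun a => ((k a + N.kernelShift k a).toNat : ℤ)) =
      k + fun a => (N.kernelShift k a : ℤ) := by
    funext a
    simp [Int.toNat_of_nonneg (N.add_kernelShift_nonneg k a)]
  rw [this]
  exact AddSubgroup.add_mem _ hk (N.kernelShift_mem k)

theorem productionNat_sub (p : N.LocRec) {k l k' l' : Letter A → ℕ}
    (hk : (fun a => (k a : ℤ)) ∈ N.totalKernel) (hk' : (fun a => (k' a : ℤ)) ∈ N.totalKernel)
    (h : ∀ a, (k a : ℤ) - l a = k' a - l' a) :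
    N.productionNat p k - N.productionNat p l = N.productionNat p k' - N.productionNat p l' := by
  have e : k + l' = k' + l := by
    funext a
    have := h a
    simp only [Pi.add_apply]
    omega
  have := congrArg (N.productionNat p) e
  rw [N.productionNat_add p hk, N.productionNat_add p hk'] at this
  rw [sub_eq_sub_iff_add_eq_add, this]

/-- The extension of `P_p` to a group homomorphism from the total kernel `K` to `ℤ ^ A`. -/
noncomputable def productionAt (p : N.LocRec) : N.totalKernel →+ (Letter A → ℤ) :=
  AddMonoidHom.mk'
    (fun k => N.productionNat p (fun a => (k.1 a + N.kernelShift k.1 a).toNat) -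
      N.productionNat p (N.kernelShift k.1))
    (by
      intro k l
      have h3 := N.productionNat_add p (l := fun a => (l.1 a + N.kernelShift l.1 a).toNat)
        (N.toNat_kernelShift_mem k.2)
      have h4 := N.productionNat_add p (l := N.kernelShift l.1) (N.kernelShift_mem k.1)
      rw [sub_add_sub_comm, ← h3, ← h4]
      refine N.productionNat_sub p (N.toNat_kernelShift_mem (k + l).2) ?_ ?_
      · exact AddSubgroup.add_mem _ (N.toNat_kernelShift_mem k.2) (N.toNat_kernelShift_mem l.2)
      · intro a
        have a1 := N.add_kernelShift_nonneg k.1 a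
        have a2 := N.add_kernelShift_nonneg l.1 a
        have a3 := N.add_kernelShift_nonneg (k + l).1 a
        have a4 : (k + l).1 a = k.1 a + l.1 a := rfl
        simp only [Pi.add_apply]
        rw [Int.toNat_of_nonneg a3, Nat.cast_add, Nat.cast_add, Int.toNat_of_nonneg a1,
          Int.toNat_of_nonneg a2, a4]
        ring)

/-- On the nonnegative vectors of `K` the homomorphism is `P_p`. -/
theorem productionAt_nat (p : N.LocRec) (k : Letter A → ℕ)
    (hk : (fun a => (k a : ℤ)) ∈ N.totalKernel) :
    N.productionAt p ⟨_, hk⟩ = N.productionNat p k := by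
  have h0 : N.productionNat p 0 = 0 := by
    simpa using N.productionNat_add p (k := 0) (l := 0) (AddSubgroup.zero_mem _)
  rw [← sub_zero (N.productionNat p k), ← h0]
  refine N.productionNat_sub p (N.toNat_kernelShift_mem hk) hk ?_
  intro a
  have := N.add_kernelShift_nonneg (fun a => (k a : ℤ)) a
  rw [Int.toNat_of_nonneg this]
  simp

variable {N}

theorem LocRec.nonempty (h : N.Irreducible) : Nonempty N.LocRec :=
  ⟨fun v => ⟨minIdem _ • (h v).1.some, _, rfl⟩⟩

/-- The production map `P : K → ℤ ^ A` of an irreducible network. The locally recurrent state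
that is used is immaterial, see `productionMap_eq`. -/
noncomputable def productionMap (h : N.Irreducible) : N.totalKernel →+ (Letter A → ℤ) :=
  N.productionAt (LocRec.nonempty h).some

open Classical in
theorem productionNat_update_gen (p : N.LocRec) {k : Letter A → ℕ}
    (hk : (fun a => (k a : ℤ)) ∈ N.totalKernel) (v : V) (a : A v) :
    N.productionNat
      (Function.update p v (MinIdeal.of ((N.proc v).toAbelianProcessor.gen a) • p v)) k =
      N.productionNat p k := by
  set p' : N.LocRec :=
    Function.update p v (MinIdeal.of ((N.proc v).toAbelianProcessor.gen a) • p v) with hp'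
  have hs : (N.step ⟨v, a⟩ (0, p.state)).2 = p'.state := by
    funext u
    by_cases h : u = v
    · subst h
      simp only [hp', step, LocRec.state, Function.update_self, RecElts.of_smul]
      rfl
    · simp only [hp', step, LocRec.state, Function.update_of_ne h]
  have h1 := N.localAct_eq p hk
  have h2 := N.localAct_eq p' hk
  simp only [localAct, add_zero] at h1 h2
  have h3 : N.exec (wordOf k ++ [⟨v, a⟩]) (fun a => (k a : ℤ), p.state) =
      N.exec ([⟨v, a⟩] ++ wordOf k) (fun a => (k a : ℤ), p.state) :=
    N.exec_perm List.perm_append_comm _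
  rw [exec_append, exec_append, h1] at h3
  have e1 : ∀ y : Letter A → ℤ, N.exec [⟨v, a⟩] (y, p.state) =
      (y + (N.step ⟨v, a⟩ (0, p.state)).1, p'.state) := by
    intro y
    have := N.exec_shift [⟨v, a⟩] 0 y p.state
    rw [zero_add] at this
    rw [this]
    simp only [exec, hs, add_comm]
  rw [e1, e1, exec_shift, h2] at h3
  have h4 := congrArg Prod.fst h3
  dsimp only at h4
  exact (add_right_cancel h4).symm

open Classical in
theorem productionNat_update_of (p : N.LocRec) {k : Letter A → ℕ}
    (hk : (fun a => (k a : ℤ)) ∈ N.totalKernel) (v : V)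
    (m : (N.proc v).toAbelianProcessor.transitionMonoid) :
    N.productionNat (Function.update p v (MinIdeal.of m • p v)) k = N.productionNat p k := by
  obtain ⟨m, hm⟩ := m
  induction hm using Submonoid.closure_induction generalizing p with
  | mem f hf =>
    obtain ⟨a, rfl⟩ := hf
    exact productionNat_update_gen p hk v a
  | one =>
    have : MinIdeal.of (⟨1, Submonoid.one_mem _⟩ :
        (N.proc v).toAbelianProcessor.transitionMonoid) • p v = p v :=
      Subtype.ext (RecElts.of_smul _ _)
    rw [this, Function.update_eq_self]
  | mul f g hf hg ihf ihg =>
    have h1 := ihg p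
    have h2 := ihf (Function.update p v (MinIdeal.of
      (⟨g, hg⟩ : (N.proc v).toAbelianProcessor.transitionMonoid) • p v))
    rw [Function.update_self, Function.update_idem, h1] at h2
    rw [← h2]
    congr 2
    refine Subtype.ext ?_
    rw [RecElts.of_smul, RecElts.of_smul, RecElts.of_smul]
    rfl

theorem productionNat_eq (h : N.Irreducible) (p p' : N.LocRec) {k : Letter A → ℕ}
    (hk : (fun a => (k a : ℤ)) ∈ N.totalKernel) :
    N.productionNat p k = N.productionNat p' k := by
  classical
  have key : ∀ (p : N.LocRec) v x, N.productionNat (Function.update p v x) k =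
      N.productionNat p k := by
    intro p v x
    obtain ⟨m, m', hm⟩ := (h v).2 x.1 (p v).1
    have h1 := productionNat_update_of (Function.update p v x) hk v m
    have h2 := productionNat_update_of p hk v m'
    have h3 : MinIdeal.of m • x = MinIdeal.of m' • p v := by
      refine Subtype.ext ?_
      rw [RecElts.of_smul, RecElts.of_smul, hm]
    rw [Function.update_self, Function.update_idem, h3, h2] at h1
    exact h1.symm
  have : ∀ s : Finset V, N.productionNat (s.piecewise p p') k = N.productionNat p' k := by
    intro s
    induction s using Finset.induction_on with
    | empty => rw [Finset.piecewise_empty]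
    | insert v s _ ih => rw [Finset.piecewise_insert, key, ih]
  simpa using this Finset.univ

theorem productionMap_eq (h : N.Irreducible) (p : N.LocRec) :
    productionMap h = N.productionAt p := by
  ext1 k
  simp only [productionMap, productionAt, AddMonoidHom.mk'_apply]
  rw [productionNat_eq h _ p (N.toNat_kernelShift_mem k.2),
    productionNat_eq h _ p (N.kernelShift_mem k.1)]

/-- Two irreducible abelian networks on the same graph with the same total alphabet are homotopic
if they have the same total kernel and the same production map. -/
structure Homotopic (N : AbelianNetwork.{uV, uE, uA, uQ} V A)
    (N' : AbelianNetwork.{uV, uE, uA, uQ'} V A)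
    [∀ v, Finite (N.Q v)] [∀ v, Finite (N'.Q v)] : Prop where
  irreducible : N.Irreducible
  irreducible' : N'.Irreducible
  kernel_eq : N.totalKernel = N'.totalKernel
  production_eq : ∀ k (hk : k ∈ N.totalKernel) (hk' : k ∈ N'.totalKernel),
    productionMap irreducible ⟨k, hk⟩ = productionMap irreducible' ⟨k, hk'⟩

end LocalAction

end AbelianNetwork

/-! ### Sandpile and rotor networks -/

section Examples

variable {V : Type uV} [Quiver.{uE + 1} V]

/-- From every other vertex there is a directed path to `s`. -/
class IsGlobalSink (s : V) : Prop where
  reach : ∀ v, v ≠ s → Nonempty (Quiver.Path v s)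

variable [∀ v : V, Fintype (Quiver.Star v)]

/-- The outdegree `d_v`, counting multiple edges and loops. -/
def outdegree (v : V) : ℕ := Fintype.card (Quiver.Star v)

open Classical in
/-- The threshold of `v`: the outdegree if `v ≠ s`, and `1` for the sink `s`. -/
noncomputable def threshold (s v : V) : ℕ := if v = s then 1 else outdegree v

theorem nonempty_star_of_path {v s : V} (p : Quiver.Path v s) (h : v ≠ s) :
    Nonempty (Quiver.Star v) := by
  induction p with
  | nil => exact absurd rfl h
  | @cons b c p e ih =>
    by_cases hb : v = b
    · subst hb
      exact ⟨⟨_, e⟩⟩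
    · exact ih hb

instance (s v : V) [hs : IsGlobalSink s] : NeZero (threshold s v) where
  out := by
    unfold threshold
    split_ifs with h
    · exact one_ne_zero
    · obtain ⟨p⟩ := hs.reach v h
      have := nonempty_star_of_path p h
      exact Fintype.card_ne_zero

/-- The processor at `v` with one-letter alphabet, state space `ℤ/r`, transition map `q ↦ q + 1`
and the given messages. -/
def cyclicProcessor {U : Type*} (r : ℕ) (o : U → ZMod r → List Unit) :
    OutputProcessor Unit (ZMod r) (fun _ : U => Unit) where
  t _ := fun q => q + 1
  t_comm _ _ := rfl
  o _ := o
  o_perm w w' h u q := by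
    have : w = w' := List.ext_getElem h.length_eq fun _ _ _ => rfl
    rw [this]

open Classical in
/-- The sandpile network with sink `s`; the letter of the alphabet at `v` is called `()`.
When the processor at `v ≠ s` moves from state `d_v - 1` to state `0`, it sends one letter along
each outgoing edge; the sink has one state and sends nothing. -/
noncomputable def sand (s : V) : AbelianNetwork.{uV, uE, 0, 0} V (fun _ => Unit) where
  Q v := ZMod (threshold s v)
  proc v := cyclicProcessor (threshold s v)
    (fun _ q => if v ≠ s ∧ q + 1 = 0 then [()] else [])

open Classical in
/-- The rotor network with sink `s`, where `ord v` is an ordering of the outgoing edges of `v`.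
When the processor at `v ≠ s` moves from state `q` to state `q + 1`, it sends one letter along
the edge in position `q` (positions are numbered from `0`); the sink has one state and sends
nothing. -/
noncomputable def rotor (s : V) (ord : ∀ v : V, Quiver.Star v ≃ Fin (outdegree v)) :
    AbelianNetwork.{uV, uE, 0, 0} V (fun _ => Unit) where
  Q v := ZMod (threshold s v)
  proc v := cyclicProcessor (threshold s v)
    (fun e q => if v ≠ s ∧ q.val = (ord v e : ℕ) then [()] else [])

instance (s : V) [IsGlobalSink s] (v : V) : Finite ((sand s).Q v) :=
  inferInstanceAs (Finite (ZMod (threshold s v)))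

instance (s : V) [IsGlobalSink s] (ord : ∀ v : V, Quiver.Star v ≃ Fin (outdegree v)) (v : V) :
    Finite ((rotor s ord).Q v) :=
  inferInstanceAs (Finite (ZMod (threshold s v)))

end Examples

/-! The group `Crit N` is the quotient of `ℤ ^ A` by the kernel of the map that sends a letter `a`
to the class of `τ_a`, and this kernel is the range of the Laplacian `I - P : K → ℤ ^ A`. On one
hand, processing `k ∈ K ∩ ℕ ^ A` from a locally recurrent state restores the state and replaces
the letters `k` by `P k`, so both inputs act in the same way. On the other hand, if two inputs
`y`, `z` lead from a locally recurrent state to the same final state, by executing the words `w`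
and `w'`, then a common continuation `u` for which `w ++ u` and `w' ++ u` both restore the initial
state exhibits `y - z` as a difference of values of the Laplacian. The Laplacian depends only on
the homotopy class.

A rotor and a sandpile processor send the same letters while they run once through their states,
which makes the two networks homotopic. They halt because every vertex `v` has a weight `c v > 0`
which for `v ≠ s` exceeds the mean of `c` over the out-neighbours of `v` by at least one: the
total weight of the waiting letters, corrected by a bounded function of the states, decreases at
each step. -/

namespace MinIdeal

variable {M : Type*} [CommMonoid M] [Finite M]

variable (M) in
/-- The homomorphism `m ↦ em` from a finite commutative monoid `M` onto the group `eM`. -/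
noncomputable def ofHom : M →* MinIdeal M where
  toFun := of
  map_one' := Subtype.ext (mul_one _)
  map_mul' m n := Subtype.ext <| by
    rw [val_mul, of, of, of, mul_mul_mul_comm, minIdem_idem.eq]

theorem ofHom_apply (m : M) : ofHom M m = of m := rfl

theorem of_val (g : MinIdeal M) : of g.1 = g := Subtype.ext (minIdem_mul_val g)

end MinIdeal

namespace AbelianProcessor

variable {I Q : Type*} (P : AbelianProcessor I Q)

theorem gen_smul (a : I) (q : Q) : P.gen a • q = P.t a q := rfl

section Monomial

variable [Fintype I]

/-- The element `∏ a, t_a ^ x a` of the transition monoid: the effect of processing `x a` letters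
`a` for every `a`. -/
def monomial (x : I → ℕ) : P.transitionMonoid := ∏ a, P.gen a ^ x a

theorem monomial_zero : P.monomial 0 = 1 := by
  simp only [monomial, Pi.zero_apply, pow_zero, Finset.prod_const_one]

theorem monomial_add (x y : I → ℕ) : P.monomial (x + y) = P.monomial x * P.monomial y := by
  simp only [monomial, Pi.add_apply, pow_add, Finset.prod_mul_distrib]

theorem monomial_single [DecidableEq I] (a : I) : P.monomial (Pi.single a 1) = P.gen a := by
  rw [monomial, Finset.prod_eq_single a]
  · rw [Pi.single_eq_same, pow_one]
  · intro b _ hb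
    rw [Pi.single_eq_of_ne hb, pow_zero]
  · exact fun ha => (ha (Finset.mem_univ a)).elim

theorem exists_monomial_eq (m : P.transitionMonoid) : ∃ x, P.monomial x = m := by
  classical
  obtain ⟨m, hm⟩ := m
  induction hm using Submonoid.closure_induction with
  | mem f hf =>
    obtain ⟨a, rfl⟩ := hf
    exact ⟨Pi.single a 1, P.monomial_single a⟩
  | one => exact ⟨0, P.monomial_zero⟩
  | mul f g hf hg ihf ihg =>
    obtain ⟨⟨x, hx⟩, ⟨y, hy⟩⟩ := And.intro ihf ihg
    exact ⟨x + y, by rw [monomial_add, hx, hy]; rfl⟩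

variable [Finite Q]

theorem of_monomial (x : I → ℕ) :
    MinIdeal.of (P.monomial x) = P.grpElt fun a => (x a : ℤ) := by
  rw [← MinIdeal.ofHom_apply, monomial, map_prod]
  simp only [map_pow, MinIdeal.ofHom_apply, grpElt, zpow_natCast]

/-- The homomorphism `grpElt` from `ℤ ^ I` to the group `eM`, the latter written additively. -/
noncomputable def grpHom : (I → ℤ) →+ Additive P.Grp where
  toFun x := Additive.ofMul (P.grpElt x)
  map_zero' := congrArg Additive.ofMul P.grpElt_zero
  map_add' x y := congrArg Additive.ofMul (P.grpElt_add x y)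

theorem grpHom_apply (x : I → ℤ) : P.grpHom x = Additive.ofMul (P.grpElt x) := rfl

theorem grpHom_surjective : Function.Surjective P.grpHom := fun g => by
  obtain ⟨x, hx⟩ := P.exists_monomial_eq g.toMul.1
  exact ⟨fun a => x a, by
    rw [grpHom_apply, ← of_monomial, hx, MinIdeal.of_val, ofMul_toMul]⟩

variable {P} in
theorem nonempty_grp_mulEquiv_of_ker_eq {Q' : Type*} [Finite Q'] {P' : AbelianProcessor I Q'}
    (h : P.grpHom.ker = P'.grpHom.ker) : Nonempty (P.Grp ≃* P'.Grp) :=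
  ⟨MulEquiv.toAdditive.symm <|
    (QuotientAddGroup.quotientKerEquivOfSurjective _ P.grpHom_surjective).symm.trans <|
      (QuotientAddGroup.quotientAddEquivOfEq h).trans <|
        QuotientAddGroup.quotientKerEquivOfSurjective _ P'.grpHom_surjective⟩

end Monomial

variable [Finite Q]

theorem of_eq_of_iff {m n : P.transitionMonoid} :
    MinIdeal.of m = MinIdeal.of n ↔ ∀ q : P.Rec, m • q.1 = n • q.1 := by
  refine ⟨fun h q => by rw [← RecElts.of_smul, h, RecElts.of_smul], fun h => ?_⟩
  refine Subtype.ext (Subtype.ext (funext fun q => ?_))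
  have hq := h ⟨minIdem _ • q, q, rfl⟩
  rwa [smul_smul, smul_smul, mul_comm m, mul_comm n] at hq

theorem grpElt_natCast_smul_val [Fintype I] (x : I → ℕ) (q : P.Rec) :
    (P.grpElt (fun a => (x a : ℤ)) • q).1 = P.monomial x • q.1 := by
  rw [← of_monomial, RecElts.of_smul]

theorem mem_kernel_iff_of_irreducible [Fintype I] (hP : P.Irreducible) (q : P.Rec) {x : I → ℤ} :
    x ∈ P.kernel ↔ P.grpElt x • q = q := by
  refine ⟨fun hx => hx q, fun hx q' => ?_⟩
  obtain ⟨m, m', hm⟩ := hP.2 q.1 q'.1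
  have h : MinIdeal.of m • q = MinIdeal.of m' • q' :=
    Subtype.ext (by rw [RecElts.of_smul, RecElts.of_smul, hm])
  have hq' : q' = ((MinIdeal.of m')⁻¹ * MinIdeal.of m) • q := by
    rw [mul_smul, h, inv_smul_smul]
  rw [hq', smul_smul, mul_comm, mul_smul, hx]

theorem natCast_mem_kernel_iff [Fintype I] (hP : P.Irreducible) (q : P.Rec) (x : I → ℕ) :
    (fun a => (x a : ℤ)) ∈ P.kernel ↔ P.monomial x • q.1 = q.1 := by
  rw [P.mem_kernel_iff_of_irreducible hP q, ← P.grpElt_natCast_smul_val]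
  exact Subtype.ext_iff

end AbelianProcessor

namespace AbelianNetwork

/-- The number of occurrences of each letter in a word. -/
noncomputable def letterCount {α : Type*} (w : List α) (a : α) : ℕ :=
  open Classical in w.count a

section LetterCount

variable {α : Type*}

theorem letterCount_eq_count [DecidableEq α] (w : List α) (a : α) :
    letterCount w a = w.count a := by
  rw [letterCount]
  congr!

theorem letterCount_append (w w' : List α) :
    letterCount (w ++ w') = letterCount w + letterCount w' :=
  funext fun _ => by
    classical
    simp only [letterCount_eq_count, List.count_append, Pi.add_apply]

theorem letterCount_cons [DecidableEq α] (a : α) (w : List α) :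
    letterCount (a :: w) = letterCount w + Pi.single a 1 := by
  funext b
  simp only [letterCount_eq_count, List.count_cons, Pi.add_apply, Pi.single_apply, beq_iff_eq,
    eq_comm (a := b)]

theorem letterCount_replicate [DecidableEq α] (n : ℕ) (a : α) :
    letterCount (List.replicate n a) = Pi.single a n := by
  funext b
  simp only [letterCount_eq_count, List.count_replicate, Pi.single_apply, beq_iff_eq,
    eq_comm (a := b)]

theorem perm_of_letterCount_eq {w w' : List α} (h : letterCount w = letterCount w') :
    w.Perm w' := by
  classical
  exact List.perm_iff_count.2 fun a => by
    rw [← letterCount_eq_count, h, letterCount_eq_count]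

end LetterCount

variable {V : Type uV} [Quiver.{uE + 1} V] {A : V → Type uA}
variable {N : AbelianNetwork.{uV, uE, uA, uQ} V A} [∀ v : V, Fintype (Quiver.Star v)]

section Words

variable (N)

/-- The change in the numbers of waiting letters when the word `w` is executed from state `q`. -/
noncomputable def displacement (w : List (Letter A)) (q : N.State) : Letter A → ℤ :=
  (N.exec w (0, q)).1

/-- The state reached from `q` by executing the word `w`. -/
noncomputable def finalState (w : List (Letter A)) (q : N.State) : N.State :=
  (N.exec w (0, q)).2

theorem sent_apply (a : Letter A) (q : N.Q a.1) (b : Letter A) :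
    N.sent a q b = ∑ e : Quiver.Star a.1,
      (letterCount (((N.proc a.1).o a.2 e q).map (Sigma.mk e.1 : A e.1 → Letter A)) b : ℤ) := by
  classical
  simp only [letterCount_eq_count, sent]

theorem exec_mk (w : List (Letter A)) (x : Letter A → ℤ) (q : N.State) :
    N.exec w (x, q) = (x + N.displacement w q, N.finalState w q) := by
  rw [← zero_add x, N.exec_shift w 0 x q, zero_add, add_comm, displacement, finalState]

theorem displacement_append (w w' : List (Letter A)) (q : N.State) :
    N.displacement (w ++ w') q =
      N.displacement w q + N.displacement w' (N.finalState w q) := by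
  rw [displacement, exec_append, exec_mk, exec_mk, zero_add]

theorem finalState_append (w w' : List (Letter A)) (q : N.State) :
    N.finalState (w ++ w') q = N.finalState w' (N.finalState w q) := by
  rw [finalState, exec_append, exec_mk, exec_mk]

theorem finalState_cons [DecidableEq V] (a : Letter A) (w : List (Letter A)) (q : N.State) :
    N.finalState (a :: w) q =
      N.finalState w (Function.update q a.1 ((N.proc a.1).t a.2 (q a.1))) := by
  rw [finalState, exec, step, exec_mk]
  congr!

theorem displacement_eq_of_perm {w w' : List (Letter A)} (h : w.Perm w') (q : N.State) :
    N.displacement w q = N.displacement w' q := by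
  rw [displacement, N.exec_perm h, displacement]

theorem finalState_apply [∀ v, Fintype (A v)] (w : List (Letter A)) (q : N.State) (v : V) :
    N.finalState w q v =
      (N.proc v).toAbelianProcessor.monomial (fun a => letterCount w ⟨v, a⟩) • q v := by
  classical
  induction w generalizing q with
  | nil => exact ((congrArg (· • q v) (AbelianProcessor.monomial_zero _)).trans (one_smul _ _)).symm
  | cons b w ih =>
    obtain ⟨u, b⟩ := b
    rw [finalState_cons, ih]
    by_cases h : v = u
    · subst h
      have hcount : (fun a => letterCount (⟨v, b⟩ :: w) (⟨v, a⟩ : Letter A)) =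
          (fun a => letterCount w ⟨v, a⟩) + Pi.single b 1 := by
        funext a
        simp [letterCount_cons, Pi.single_apply]
      rw [hcount, AbelianProcessor.monomial_add, AbelianProcessor.monomial_single, mul_smul,
        Function.update_self, AbelianProcessor.gen_smul]
    · have hcount : (fun a => letterCount (⟨u, b⟩ :: w) (⟨v, a⟩ : Letter A)) =
          fun a => letterCount w ⟨v, a⟩ := by
        funext a
        simp [letterCount_cons, h]
      rw [hcount, Function.update_of_ne h]

theorem displacement_singleton [DecidableEq (Letter A)] (a : Letter A) (q : N.State) :
    N.displacement [a] q = N.sent a (q a.1) - Pi.single a 1 := by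
  rw [displacement, exec, exec, step, zero_sub, neg_add_eq_sub]
  congr!

theorem finalState_replicate_self (a : Letter A) (n : ℕ) (q : N.State) :
    N.finalState (List.replicate n a) q a.1 =
      (N.proc a.1).toAbelianProcessor.gen a.2 ^ n • q a.1 := by
  classical
  induction n generalizing q with
  | zero => rfl
  | succ n ih =>
    rw [List.replicate_succ, finalState_cons, ih, Function.update_self, pow_succ, mul_smul,
      AbelianProcessor.gen_smul]

theorem displacement_replicate [DecidableEq (Letter A)] (a : Letter A) (n : ℕ) (q : N.State) :
    N.displacement (List.replicate n a) q =
      ∑ i ∈ Finset.range n,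
          N.sent a ((N.proc a.1).toAbelianProcessor.gen a.2 ^ i • q a.1) -
        n • Pi.single a 1 := by
  induction n with
  | zero => simp [displacement, exec]
  | succ n ih =>
    rw [List.replicate_succ', displacement_append, displacement_singleton,
      finalState_replicate_self, ih, Finset.sum_range_succ, succ_nsmul]
    abel

theorem isLegal_of_letterCount_le {w : List (Letter A)} {s : N.TotalState}
    (h : ∀ a, (letterCount w a : ℤ) ≤ s.1 a) : N.IsLegal w s := by
  classical
  induction w generalizing s with
  | nil => trivial
  | cons a w ih =>
    have hcount (b : Letter A) :
        (letterCount w b : ℤ) + (Pi.single a 1 : Letter A → ℤ) b ≤ s.1 b := by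
      have hb := h b
      rw [letterCount_cons, Pi.add_apply, Pi.single_apply] at hb
      rw [Pi.single_apply]
      split_ifs at hb ⊢ <;> simpa using hb
    refine ⟨?_, ih fun b => ?_⟩
    · have ha := hcount a
      rw [Pi.single_eq_same] at ha
      omega
    · have hsent : 0 ≤ N.sent a (s.2 a.1) b := N.sent_nonneg a _ b
      have hb := hcount b
      have hstep : (N.step a s).1 b =
          s.1 b - (Pi.single a 1 : Letter A → ℤ) b + N.sent a (s.2 a.1) b := by
        rw [step]
        congr!
      omega

variable [Fintype V] [∀ v, Fintype (A v)]

theorem letterCount_wordOf (x : Letter A → ℕ) : letterCount (wordOf x) = x :=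
  funext fun a => by
    classical
    rw [letterCount_eq_count]
    convert count_wordOf x a

theorem productionNat_eq_add_displacement [∀ v, Finite (N.Q v)] (p : N.LocRec)
    (k : Letter A → ℕ) :
    N.productionNat p k = (fun a => (k a : ℤ)) + N.displacement (wordOf k) p.state := by
  rw [productionNat, localAct, add_zero, exec_mk]

end Words

section GlobalAction

variable (h : N.HaltsOnAllInputs)

include h in
theorem exists_isLegal_exec_eq (x : Letter A → ℕ) (q : N.State) :
    ∃ w, N.IsLegal w (fun a => (x a : ℤ), q) ∧
      N.exec w (fun a => (x a : ℤ), q) = (0, globalAct h x q) := by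
  obtain ⟨w, hl, hc⟩ := h x q
  have hnonneg := N.exec_nonneg (fun a => Int.natCast_nonneg (x a)) hl
  exact ⟨w, hl, Prod.ext (le_antisymm hc hnonneg) (globalAct_eq h hl hc).symm⟩

theorem globalAct_zero (q : N.State) : globalAct h 0 q = q :=
  globalAct_eq h (w := []) trivial fun _ => (Nat.cast_zero (R := ℤ)).le

theorem globalAct_eq_of_exec_eq {x y : Letter A → ℕ} {q q' : N.State} {w : List (Letter A)}
    (hl : N.IsLegal w (fun a => (x a : ℤ), q))
    (hw : N.exec w (fun a => (x a : ℤ), q) = (fun a => (y a : ℤ), q')) :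
    globalAct h x q = globalAct h y q' := by
  obtain ⟨w', hl', hw'⟩ := exists_isLegal_exec_eq h y q'
  have hexec : N.exec (w ++ w') (fun a => (x a : ℤ), q) = (0, globalAct h y q') := by
    rw [exec_append, hw, hw']
  have hlegal : N.IsLegal (w ++ w') (fun a => (x a : ℤ), q) := by
    rw [isLegal_append, hw]
    exact ⟨hl, hl'⟩
  rw [globalAct_eq h hlegal (congrArg Prod.fst hexec).le, hexec]

theorem exists_globalAct_eq_finalState_finalState {x : Letter A → ℕ} {q : N.State}
    {w : List (Letter A)} (hl : N.IsLegal w (fun a => (x a : ℤ), q)) :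
    ∃ w', globalAct h x q = N.finalState w' (N.finalState w q) := by
  have hnonneg := N.exec_nonneg (fun a => Int.natCast_nonneg (x a)) hl
  rw [exec_mk] at hnonneg
  lift (fun a => (x a : ℤ)) + N.displacement w q to Letter A → ℕ using hnonneg with y hy
  obtain ⟨w', -, hw'⟩ := exists_isLegal_exec_eq h y (N.finalState w q)
  refine ⟨w', ?_⟩
  rw [globalAct_eq_of_exec_eq h (y := y) hl (by rw [exec_mk]; exact congrArg (·, _) hy.symm)]
  rw [exec_mk] at hw'
  exact (congrArg Prod.snd hw').symm

variable [Fintype V] [∀ v, Fintype (A v)]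

theorem globalProcessor_monomial_smul (x : Letter A → ℕ) (q : N.State) :
    (globalProcessor h).monomial x • q = globalAct h x q := by
  classical
  suffices hw : ∀ (w : List (Letter A)) (q : N.State),
      (globalProcessor h).monomial (letterCount w) • q = globalAct h (letterCount w) q by
    rw [← letterCount_wordOf x, hw]
  intro w
  induction w with
  | nil =>
    intro q
    exact (congrArg (· • q) (AbelianProcessor.monomial_zero _)).trans
      ((one_smul _ q).trans (globalAct_zero h q).symm)
  | cons a w ih =>
    intro q
    have hgen : (globalProcessor h).gen a • q = globalAct h (Pi.single a 1) q := by
      rw [AbelianProcessor.gen_smul, globalProcessor]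
    rw [letterCount_cons, AbelianProcessor.monomial_add, AbelianProcessor.monomial_single,
      mul_smul, hgen, ih, add_comm, globalAct_add]

variable [∀ v, Finite (N.Q v)]

theorem exists_locRec_state_eq (q : (globalProcessor h).Rec) :
    ∃ p : N.LocRec, p.state = q.1 := by
  choose x hx using fun v =>
    (N.proc v).toAbelianProcessor.exists_monomial_eq (minIdem _)
  let y : Letter A → ℕ := fun a => x a.1 a.2
  obtain ⟨_, q, rfl⟩ := q
  obtain ⟨m, hm⟩ := dvd_minIdem ((globalProcessor h).monomial y)
  have hl : N.IsLegal (wordOf y) (fun a => (y a : ℤ), m • q) :=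
    N.isLegal_of_letterCount_le fun a => by rw [letterCount_wordOf]
  obtain ⟨w, hw⟩ := exists_globalAct_eq_finalState_finalState h hl
  have hrec (v : V) : ∃ r, globalAct h y (m • q) v =
      minIdem (N.proc v).toAbelianProcessor.transitionMonoid • r :=
    ⟨_, by rw [hw, finalState_apply, finalState_apply, letterCount_wordOf, hx v, smul_smul,
      mul_comm, mul_smul]⟩
  have hminIdem : globalAct h y (m • q) =
      minIdem (globalProcessor h).transitionMonoid • q := by
    rw [hm, mul_smul, globalProcessor_monomial_smul]
  exact ⟨fun v => ⟨_, hrec v⟩, hminIdem⟩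

theorem grpElt_globalProcessor_natCast_eq_iff {x y : Letter A → ℕ} :
    ((globalProcessor h).grpElt fun a => (x a : ℤ)) =
        ((globalProcessor h).grpElt fun a => (y a : ℤ)) ↔
      ∀ q : (globalProcessor h).Rec, globalAct h x q.1 = globalAct h y q.1 := by
  rw [← AbelianProcessor.of_monomial, ← AbelianProcessor.of_monomial,
    AbelianProcessor.of_eq_of_iff]
  simp only [globalProcessor_monomial_smul]

end GlobalAction

section Laplacian

variable [∀ v, Fintype (A v)] [∀ v, Finite (N.Q v)]

theorem letterCount_mem_totalKernel_iff (hN : N.Irreducible) (p : N.LocRec)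
    (w : List (Letter A)) :
    (fun a => (letterCount w a : ℤ)) ∈ N.totalKernel ↔ N.finalState w p.state = p.state := by
  rw [funext_iff]
  refine forall_congr' fun v => ?_
  rw [finalState_apply]
  exact AbelianProcessor.natCast_mem_kernel_iff _ (hN v) (p v) _

variable [Fintype V]

theorem totalKernel_hom_ext {B : Type*} [AddCommGroup B] {f g : N.totalKernel →+ B}
    (h : ∀ (k : Letter A → ℕ) (hk : (fun a => (k a : ℤ)) ∈ N.totalKernel),
      f ⟨_, hk⟩ = g ⟨_, hk⟩) : f = g := by
  ext ⟨k, hk⟩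
  have hsub : (⟨k, hk⟩ : N.totalKernel) =
      ⟨_, N.toNat_kernelShift_mem hk⟩ - ⟨_, N.kernelShift_mem k⟩ :=
    Subtype.ext <| funext fun a =>
      ((sub_eq_iff_eq_add.2 (Int.toNat_of_nonneg (N.add_kernelShift_nonneg k a))).symm)
  rw [hsub, map_sub, map_sub, h, h]

variable (N) in
theorem exists_letterCount_append_mem_totalKernel (w : List (Letter A)) :
    ∃ u, (fun a => (letterCount (w ++ u) a : ℤ)) ∈ N.totalKernel := by
  let x : Letter A → ℤ := fun a => -(letterCount w a : ℤ)
  refine ⟨wordOf fun a => (x a + N.kernelShift x a).toNat, ?_⟩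
  convert N.kernelShift_mem x using 2 with a
  rw [letterCount_append, letterCount_wordOf, Pi.add_apply, Nat.cast_add,
    Int.toNat_of_nonneg (N.add_kernelShift_nonneg x a), add_neg_cancel_left]

theorem productionMap_letterCount (hN : N.Irreducible) (p : N.LocRec) {w : List (Letter A)}
    (hw : (fun a => (letterCount w a : ℤ)) ∈ N.totalKernel) :
    productionMap hN ⟨_, hw⟩ = (fun a => (letterCount w a : ℤ)) + N.displacement w p.state := by
  rw [productionMap_eq hN p, productionAt_nat, productionNat_eq_add_displacement,
    displacement_eq_of_perm N (perm_of_letterCount_eq (letterCount_wordOf _))]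

/-- The Laplacian `I - P : K → ℤ ^ A` of an irreducible network: it sends a vector of letters to
the loss of letters when a locally recurrent state processes them. -/
noncomputable def laplacian (hN : N.Irreducible) : N.totalKernel →+ (Letter A → ℤ) :=
  N.totalKernel.subtype - productionMap hN

theorem laplacian_apply (hN : N.Irreducible) (k : N.totalKernel) :
    laplacian hN k = k.1 - productionMap hN k := rfl

theorem laplacian_letterCount (hN : N.Irreducible) (p : N.LocRec) {w : List (Letter A)}
    (hw : (fun a => (letterCount w a : ℤ)) ∈ N.totalKernel) :
    laplacian hN ⟨_, hw⟩ = -N.displacement w p.state := by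
  rw [laplacian_apply, productionMap_letterCount hN p, sub_add_cancel_left]

theorem exists_laplacian_eq (hN : N.Irreducible) (p : N.LocRec) {w w' : List (Letter A)}
    (h : N.finalState w p.state = N.finalState w' p.state) :
    ∃ k, laplacian hN k = N.displacement w' p.state - N.displacement w p.state := by
  obtain ⟨u, hu⟩ := N.exists_letterCount_append_mem_totalKernel w
  have hu' : (fun a => (letterCount (w' ++ u) a : ℤ)) ∈ N.totalKernel := by
    rw [letterCount_mem_totalKernel_iff hN p, finalState_append] at hu ⊢
    rwa [← h]
  refine ⟨⟨_, hu⟩ - ⟨_, hu'⟩, ?_⟩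
  rw [map_sub, laplacian_letterCount hN p, laplacian_letterCount hN p, displacement_append,
    displacement_append, h]
  abel

variable (h : N.HaltsOnAllInputs) (hN : N.Irreducible)

theorem grpElt_productionMap_natCast (k : Letter A → ℕ)
    (hk : (fun a => (k a : ℤ)) ∈ N.totalKernel) :
    (globalProcessor h).grpElt (productionMap hN ⟨_, hk⟩) =
      (globalProcessor h).grpElt fun a => (k a : ℤ) := by
  have hl (p : N.LocRec) : N.IsLegal (wordOf k) (fun a => (k a : ℤ), p.state) :=
    N.isLegal_of_letterCount_le fun a => by rw [letterCount_wordOf]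
  have hexec (p : N.LocRec) : N.exec (wordOf k) (fun a => (k a : ℤ), p.state) =
      (productionMap hN ⟨_, hk⟩, p.state) := by
    have := N.localAct_eq p hk
    rwa [localAct, add_zero, ← N.productionAt_nat p k hk, ← productionMap_eq hN p] at this
  obtain ⟨p₀⟩ := LocRec.nonempty hN
  have hnonneg := N.exec_nonneg (fun a => Int.natCast_nonneg (k a)) (hl p₀)
  rw [hexec] at hnonneg
  lift productionMap hN ⟨_, hk⟩ to Letter A → ℕ using hnonneg with y
  refine (grpElt_globalProcessor_natCast_eq_iff h).2 fun q => ?_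
  obtain ⟨p, hp⟩ := exists_locRec_state_eq h q
  rw [← hp]
  exact (globalAct_eq_of_exec_eq h (hl p) (hexec p)).symm

theorem exists_laplacian_eq_natCast_sub {y z : Letter A → ℕ}
    (hyz : ((globalProcessor h).grpElt fun a => (y a : ℤ)) =
      (globalProcessor h).grpElt fun a => (z a : ℤ)) :
    ∃ k, laplacian hN k = (fun a => (y a : ℤ)) - fun a => (z a : ℤ) := by
  rw [grpElt_globalProcessor_natCast_eq_iff] at hyz
  let q : (globalProcessor h).Rec := ⟨minIdem _ • fun v => (hN v).1.some, _, rfl⟩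
  obtain ⟨p, hp⟩ := exists_locRec_state_eq h q
  obtain ⟨w, -, hw⟩ := exists_isLegal_exec_eq h y p.state
  obtain ⟨w', -, hw'⟩ := exists_isLegal_exec_eq h z p.state
  rw [exec_mk, Prod.mk.injEq, hp] at hw hw'
  obtain ⟨k, hk⟩ := exists_laplacian_eq hN p (w := w) (w' := w')
    (by rw [hp, hw.2, hw'.2, hyz q])
  refine ⟨k, ?_⟩
  rw [hk, hp, ← neg_eq_of_add_eq_zero_right hw.1, ← neg_eq_of_add_eq_zero_right hw'.1]
  abel

theorem ker_grpHom_globalProcessor :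
    (globalProcessor h).grpHom.ker = (laplacian hN).range := by
  refine le_antisymm (fun x hx => ?_) ?_
  · have hpos : (fun a => ((x a).toNat : ℤ)) = x + fun a => ((-x a).toNat : ℤ) :=
      funext fun a => by simp only [Pi.add_apply]; omega
    have hx : (globalProcessor h).grpElt x = 1 := hx
    obtain ⟨k, hk⟩ := exists_laplacian_eq_natCast_sub h hN
      (y := fun a => (x a).toNat) (z := fun a => (-x a).toNat)
      (by rw [hpos, AbelianProcessor.grpElt_add, hx, one_mul])
    exact ⟨k, by rw [hk, hpos, add_sub_cancel_right]⟩
  · rintro _ ⟨k, rfl⟩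
    have hcomp : (globalProcessor h).grpHom.comp (productionMap hN) =
        (globalProcessor h).grpHom.comp N.totalKernel.subtype :=
      totalKernel_hom_ext fun k hk =>
        congrArg Additive.ofMul (grpElt_productionMap_natCast h hN k hk)
    rw [AddMonoidHom.mem_ker, laplacian_apply, map_sub, sub_eq_zero]
    exact (DFunLike.congr_fun hcomp k).symm

theorem Homotopic.range_laplacian_eq {N' : AbelianNetwork.{uV, uE, uA, uQ'} V A}
    [∀ v, Finite (N'.Q v)] (H : Homotopic N N') :
    (laplacian H.irreducible).range = (laplacian H.irreducible').range := by
  ext x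
  simp only [AddMonoidHom.mem_range, Subtype.exists, laplacian_apply]
  constructor
  · rintro ⟨k, hk, rfl⟩
    have hk' : k ∈ N'.totalKernel := H.kernel_eq ▸ hk
    exact ⟨k, hk', by rw [H.production_eq k hk hk']⟩
  · rintro ⟨k, hk', rfl⟩
    have hk : k ∈ N.totalKernel := H.kernel_eq ▸ hk'
    exact ⟨k, hk, by rw [H.production_eq k hk hk']⟩

theorem Homotopic.nonempty_crit_mulEquiv {N' : AbelianNetwork.{uV, uE, uA, uQ'} V A}
    [∀ v, Finite (N'.Q v)] (H : Homotopic N N') (h : N.HaltsOnAllInputs)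
    (h' : N'.HaltsOnAllInputs) : Nonempty (Crit h ≃* Crit h') :=
  AbelianProcessor.nonempty_grp_mulEquiv_of_ker_eq <| by
    rw [ker_grpHom_globalProcessor h H.irreducible, ker_grpHom_globalProcessor h' H.irreducible',
      H.range_laplacian_eq]

end Laplacian

section Halting

theorem haltsOnAllInputs_of_decreasing (Φ : N.TotalState → ℤ) (hΦ : ∀ s, 0 ≤ s.1 → 0 ≤ Φ s)
    (hstep : ∀ a s, Φ (N.step a s) < Φ s) : N.HaltsOnAllInputs := by
  suffices hs : ∀ s : N.TotalState, 0 ≤ s.1 → ∃ w, N.IsLegal w s ∧ N.IsComplete w s from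
    fun x q => hs _ fun a => Int.natCast_nonneg (x a)
  intro s
  induction s using (measure fun s => (Φ s).toNat).wf.induction with
  | _ s ih =>
    intro hs
    by_cases hcomplete : s.1 ≤ 0
    · exact ⟨[], trivial, hcomplete⟩
    · obtain ⟨a, ha⟩ : ∃ a, 0 < s.1 a := by
        by_contra! hle
        exact hcomplete hle
      have hnonneg : 0 ≤ (N.step a s).1 := N.exec_nonneg (w := [a]) hs ⟨ha, trivial⟩
      have hlt : (Φ (N.step a s)).toNat < (Φ s).toNat := by
        have := hΦ _ hnonneg
        have := hstep a s
        omega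
      obtain ⟨w, hw⟩ := ih _ hlt hnonneg
      exact ⟨a :: w, ⟨ha, hw.1⟩, hw.2⟩

variable [Fintype V]

theorem sum_state_step (ψ : ∀ v, N.Q v → ℤ) (a : Letter A) (s : N.TotalState) :
    ∑ v, ψ v ((N.step a s).2 v) =
      ∑ v, ψ v (s.2 v) + (ψ a.1 ((N.proc a.1).t a.2 (s.2 a.1)) - ψ a.1 (s.2 a.1)) := by
  classical
  rw [← sub_eq_iff_eq_add', ← Finset.sum_sub_distrib, Finset.sum_eq_single a.1]
  · simp [step]
  · intro v _ hv
    simp [step, hv]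
  · simp

variable [∀ v, Fintype (A v)]

theorem dotProduct_step (c : Letter A → ℤ) (a : Letter A) (s : N.TotalState) :
    c ⬝ᵥ (N.step a s).1 = c ⬝ᵥ s.1 + (c ⬝ᵥ N.sent a (s.2 a.1) - c a) := by
  classical
  have hstep : (N.step a s).1 = s.1 - Pi.single a 1 + N.sent a (s.2 a.1) := by
    rw [step]
  rw [hstep, dotProduct_add, dotProduct_sub, dotProduct_single_one]
  ring

theorem haltsOnAllInputs_of_potential (c : Letter A → ℤ) (hc : 0 ≤ c) (ψ : ∀ v, N.Q v → ℤ)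
    (hψ : ∀ v, 0 ≤ ψ v)
    (hstep : ∀ (a : Letter A) (q : N.Q a.1),
      c ⬝ᵥ N.sent a q + ψ a.1 ((N.proc a.1).t a.2 q) < c a + ψ a.1 q) :
    N.HaltsOnAllInputs := by
  refine haltsOnAllInputs_of_decreasing (fun s => c ⬝ᵥ s.1 + ∑ v, ψ v (s.2 v))
    (fun s hs => add_nonneg (dotProduct_nonneg_of_nonneg hc hs)
      (Finset.sum_nonneg fun v _ => hψ v _)) fun a s => ?_
  have := hstep a (s.2 a.1)
  rw [dotProduct_step, sum_state_step]
  linarith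

end Halting

end AbelianNetwork

section ZMod

variable {r : ℕ} [NeZero r]

theorem sum_range_natCast_zmod {B : Type*} [AddCommMonoid B] (f : ZMod r → B) :
    ∑ i ∈ Finset.range r, f i = ∑ z, f z :=
  Finset.sum_bij' (fun i _ => (i : ZMod r)) (fun z _ => z.val)
    (fun _ _ => Finset.mem_univ _) (fun z _ => Finset.mem_range.2 z.val_lt)
    (fun _ hi => ZMod.val_cast_of_lt (Finset.mem_range.1 hi)) (fun z _ => ZMod.natCast_zmod_val z)
    (fun _ _ => rfl)

theorem exists_nonneg_shift_le_add {B : Type*} [AddCommGroup B] [LinearOrder B]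
    [IsOrderedAddMonoid B] {g : ZMod r → B} (hg : 0 ≤ ∑ z, g z) :
    ∃ ψ : ZMod r → B, 0 ≤ ψ ∧ ∀ z, ψ (z + 1) ≤ ψ z + g z := by
  let S : ZMod r → B := fun z => ∑ i ∈ Finset.range z.val, g i
  have hstep (z : ZMod r) : S (z + 1) ≤ S z + g z := by
    have hsucc : S z + g z = ∑ i ∈ Finset.range (z.val + 1), g i := by
      rw [Finset.sum_range_succ, ZMod.natCast_zmod_val]
    have hcast : z + 1 = ((z.val + 1 : ℕ) : ZMod r) := by
      rw [Nat.cast_add_one, ZMod.natCast_zmod_val]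
    rw [hsucc]
    obtain hlt | heq := (Nat.succ_le_of_lt z.val_lt).lt_or_eq
    · simp only [S, hcast, ZMod.val_cast_of_lt hlt, le_refl]
    · rw [show z + 1 = 0 by rw [hcast, ← Nat.succ_eq_add_one, heq, ZMod.natCast_self],
        ← Nat.succ_eq_add_one, heq, sum_range_natCast_zmod]
      simpa only [S, ZMod.val_zero, Finset.sum_range_zero] using hg
  obtain ⟨m, hm⟩ := (Set.finite_range S).bddBelow
  refine ⟨fun z => S z - m, fun z => sub_nonneg.2 (hm (Set.mem_range_self z)), fun z => ?_⟩
  rw [sub_add_eq_add_sub]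
  exact sub_le_sub_right (hstep z) m

end ZMod

namespace cyclicProcessor

variable {U : Type*} {r : ℕ} (o : U → ZMod r → List Unit)

theorem gen_pow_smul (n : ℕ) (q : ZMod r) :
    (cyclicProcessor r o).toAbelianProcessor.gen () ^ n • q = q + n := by
  induction n generalizing q with
  | zero => rw [pow_zero, one_smul, Nat.cast_zero, add_zero]
  | succ n ih =>
    rw [pow_succ, mul_smul, ih, Nat.cast_succ, add_comm (n : ZMod r), ← add_assoc]
    rfl

theorem monomial_smul (x : Unit → ℕ) (q : ZMod r) :
    (cyclicProcessor r o).toAbelianProcessor.monomial x • q = q + x () := by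
  rw [AbelianProcessor.monomial, Fintype.prod_unique, PUnit.default_eq_unit, gen_pow_smul]

variable [NeZero r]

theorem irreducible : (cyclicProcessor r o).toAbelianProcessor.Irreducible :=
  ⟨⟨0⟩, fun q q' => ⟨(cyclicProcessor r o).toAbelianProcessor.gen () ^ (q' - q).val, 1, by
    rw [gen_pow_smul, ZMod.natCast_zmod_val, add_sub_cancel, one_smul]⟩⟩

theorem natCast_mem_kernel_iff (x : Unit → ℕ) :
    (fun a => (x a : ℤ)) ∈ (cyclicProcessor r o).toAbelianProcessor.kernel ↔ r ∣ x () := by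
  rw [AbelianProcessor.natCast_mem_kernel_iff _ (irreducible o) ⟨minIdem _ • (0 : ZMod r), 0, rfl⟩,
    monomial_smul, add_eq_left, ZMod.natCast_eq_zero_iff]

end cyclicProcessor

section Cyclic

variable {V : Type uV} [Quiver.{uE + 1} V]

/-- The network of cyclic processors with one letter, called `()`, at each vertex. It generalizes
both sandpile and rotor networks. -/
abbrev cyclicNetwork (r : V → ℕ) (o : ∀ v, Quiver.Star v → ZMod (r v) → List Unit) :
    AbelianNetwork.{uV, uE, 0, 0} V (fun _ => Unit) where
  Q v := ZMod (r v)
  proc v := cyclicProcessor (r v) (o v)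

namespace cyclicNetwork

open AbelianNetwork

variable {r : V → ℕ} (o : ∀ v, Quiver.Star v → ZMod (r v) → List Unit)

section Sent

variable [∀ v : V, Fintype (Quiver.Star v)]

theorem sent_eq [DecidableEq (Letter fun _ : V => Unit)] (v : V) (q : ZMod (r v)) :
    (cyclicNetwork r o).sent ⟨v, ()⟩ q =
      ∑ e : Quiver.Star v, Pi.single ⟨e.1, ()⟩ ((o v e q).length : ℤ) := by
  funext b
  rw [sent_apply, Finset.sum_apply]
  refine Finset.sum_congr rfl fun e _ => ?_
  have hmap : (o v e q).map (Sigma.mk (β := fun _ : V => Unit) e.1) =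
      List.replicate (o v e q).length ⟨e.1, ()⟩ :=
    List.map_eq_replicate_iff.2 fun _ _ => rfl
  refine (congrArg (fun l => (letterCount l b : ℤ)) hmap).trans ?_
  rw [letterCount_replicate, Pi.single_apply, Pi.single_apply, Nat.cast_ite, Nat.cast_zero]

variable [∀ v, NeZero (r v)]

/-- The number of letters that the processor at `v` sends along the edge `e` while it runs once
through its states. -/
noncomputable def edgeLoad (v : V) (e : Quiver.Star v) : ℕ := ∑ z, (o v e z).length

theorem sum_sent [DecidableEq (Letter fun _ : V => Unit)] (v : V) :
    ∑ z : ZMod (r v), (cyclicNetwork r o).sent ⟨v, ()⟩ z =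
      ∑ e : Quiver.Star v, Pi.single ⟨e.1, ()⟩ (edgeLoad o v e : ℤ) := by
  simp only [sent_eq, edgeLoad, Nat.cast_sum]
  rw [Finset.sum_comm]
  exact Finset.sum_congr rfl fun e _ =>
    (map_sum (AddMonoidHom.single (fun _ => ℤ) _) _ _).symm

end Sent

variable [∀ v, NeZero (r v)]

theorem irreducible : (cyclicNetwork r o).Irreducible :=
  fun v => cyclicProcessor.irreducible (o v)

instance (v : V) : Finite ((cyclicNetwork r o).Q v) := inferInstanceAs (Finite (ZMod (r v)))

theorem natCast_mem_totalKernel_iff (k : (Letter fun _ : V => Unit) → ℕ) :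
    (fun a => (k a : ℤ)) ∈ (cyclicNetwork r o).totalKernel ↔ ∀ v, r v ∣ k ⟨v, ()⟩ :=
  forall_congr' fun v => cyclicProcessor.natCast_mem_kernel_iff (o v) fun a => k ⟨v, a⟩

/-- The element of the total kernel that runs the processor at `v` once through its states. -/
noncomputable def cycle (v : V) : (cyclicNetwork r o).totalKernel :=
  ⟨fun a => (letterCount (List.replicate (r v) (⟨v, ()⟩ : Letter fun _ : V => Unit)) a : ℤ),
    (natCast_mem_totalKernel_iff o _).2 fun u => by
      classical
      rw [letterCount_replicate, Pi.single_apply]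
      split_ifs with h
      · obtain rfl : u = v := congrArg Sigma.fst h
        exact dvd_rfl
      · exact dvd_zero _⟩

variable [∀ v : V, Fintype (Quiver.Star v)]

theorem haltsOnAllInputs [Finite V] (c : V → ℤ) (hc : 0 ≤ c)
    (h : ∀ v, ∑ e : Quiver.Star v, c e.1 * edgeLoad o v e ≤ r v * (c v - 1)) :
    (cyclicNetwork r o).HaltsOnAllInputs := by
  classical
  have := Fintype.ofFinite V
  let c' : (Letter fun _ : V => Unit) → ℤ := fun a => c a.1
  have hg (v : V) : 0 ≤ ∑ z, (c v - 1 - c' ⬝ᵥ (cyclicNetwork r o).sent ⟨v, ()⟩ z) := by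
    rw [Finset.sum_sub_distrib, ← dotProduct_sum, sum_sent, dotProduct_sum, sub_nonneg]
    simp only [dotProduct_single, Finset.sum_const, nsmul_eq_mul, Finset.card_univ, ZMod.card]
    exact h v
  choose ψ hψ hstep using fun v => exists_nonneg_shift_le_add (hg v)
  refine haltsOnAllInputs_of_potential c' (fun a => hc a.1) ψ hψ ?_
  rintro ⟨v, _⟩ (q : ZMod (r v))
  have hlt : c' ⬝ᵥ (cyclicNetwork r o).sent ⟨v, ()⟩ q + ψ v (q + 1) < c v + ψ v q := by
    linarith [hstep v q]
  exact hlt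

variable [Fintype V]

theorem hom_ext_cycle {B : Type*} [AddCommGroup B] {f g : (cyclicNetwork r o).totalKernel →+ B}
    (h : ∀ v, f (cycle o v) = g (cycle o v)) : f = g := by
  classical
  refine totalKernel_hom_ext fun k hk => ?_
  have hsum : (⟨_, hk⟩ : (cyclicNetwork r o).totalKernel) =
      ∑ v, (k ⟨v, ()⟩ / r v) • cycle o v := by
    ext ⟨u, ⟨⟩⟩
    rw [AddSubgroup.val_finsetSum, Finset.sum_apply, Finset.sum_eq_single u]
    · have hdiv := Nat.div_mul_cancel ((natCast_mem_totalKernel_iff o k).1 hk u)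
      simp only [cycle, letterCount_replicate, AddSubgroup.coe_nsmul, Pi.smul_apply,
        Pi.single_eq_same, nsmul_eq_mul]
      exact_mod_cast hdiv.symm
    · intro v _ hv
      simp [cycle, letterCount_replicate, hv.symm]
    · simp
  simp only [hsum, map_sum, map_nsmul, h]

theorem productionMap_cycle [DecidableEq (Letter fun _ : V => Unit)]
    (hN : (cyclicNetwork r o).Irreducible) (v : V) :
    productionMap hN (cycle o v) =
      ∑ e : Quiver.Star v, Pi.single ⟨e.1, ()⟩ (edgeLoad o v e : ℤ) := by
  classical
  obtain ⟨p⟩ := LocRec.nonempty hN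
  have hsum : ∑ i ∈ Finset.range (r v), (cyclicNetwork r o).sent ⟨v, ()⟩
        (((cyclicNetwork r o).proc v).toAbelianProcessor.gen () ^ i • p.state v) =
      ∑ z, (cyclicNetwork r o).sent ⟨v, ()⟩ z := by
    simp only [cyclicProcessor.gen_pow_smul]
    rw [sum_range_natCast_zmod fun z : ZMod (r v) =>
      (cyclicNetwork r o).sent ⟨v, ()⟩ (p.state v + z)]
    exact Equiv.sum_comp (Equiv.addLeft (p.state v : ZMod (r v))) _
  rw [cycle, productionMap_letterCount hN p, displacement_replicate, hsum, sum_sent,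
    letterCount_replicate]
  refine add_eq_of_eq_sub' (sub_right_inj.2 (funext fun a => ?_))
  simp [Pi.single_apply]

theorem homotopic (o' : ∀ v, Quiver.Star v → ZMod (r v) → List Unit)
    (h : ∀ v e, edgeLoad o v e = edgeLoad o' v e) :
    Homotopic (cyclicNetwork r o) (cyclicNetwork r o') where
  irreducible := irreducible o
  irreducible' := irreducible o'
  kernel_eq := rfl
  production_eq k hk _ := by
    classical
    have hK : (cyclicNetwork r o).totalKernel ≤ (cyclicNetwork r o').totalKernel := le_rfl
    have hP : productionMap (irreducible o) =
        (productionMap (irreducible o')).comp (AddSubgroup.inclusion hK) :=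
      hom_ext_cycle o fun v => by
        rw [productionMap_cycle]
        refine .trans ?_ (productionMap_cycle o' (irreducible o') v).symm
        simp only [h]
    rw [hP, AddMonoidHom.comp_apply]
    rfl

end cyclicNetwork

end Cyclic

section Sink

variable {V : Type uV} [Quiver.{uE + 1} V] (s : V) [IsGlobalSink s]

theorem nonempty_path_of_isGlobalSink (v : V) : Nonempty (Quiver.Path v s) := by
  obtain rfl | hv := eq_or_ne v s
  · exact ⟨Quiver.Path.nil⟩
  · exact IsGlobalSink.reach v hv

theorem exists_star_lt_of_isGlobalSink :
    ∃ ℓ : V → ℕ, ∀ v, v ≠ s → ∃ e : Quiver.Star v, ℓ e.1 < ℓ v := by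
  refine ⟨fun v => ⨅ p : Quiver.Path v s, p.length, fun v hv => ?_⟩
  have := nonempty_path_of_isGlobalSink s v
  obtain ⟨p, hp⟩ := ciInf_mem fun p : Quiver.Path v s => p.length
  obtain ⟨u, e, p', -, hp'⟩ :=
    p.length_ne_zero_iff_eq_comp.1 fun h => hv (Quiver.Path.eq_of_length_zero p h)
  refine ⟨⟨u, e⟩, (ciInf_le (OrderBot.bddBelow _) p').trans_lt ?_⟩
  dsimp only at hp ⊢
  omega

variable [∀ v : V, Fintype (Quiver.Star v)]

open Classical in
theorem edgeLoad_sand (v : V) (e : Quiver.Star v) :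
    cyclicNetwork.edgeLoad (r := threshold s)
      (fun v _ z => if v ≠ s ∧ z + 1 = 0 then [()] else []) v e = if v = s then 0 else 1 := by
  simp only [cyclicNetwork.edgeLoad, ← eq_neg_iff_add_eq_zero]
  by_cases hv : v = s <;> simp [hv, apply_ite]

open Classical in
theorem edgeLoad_rotor (ord : ∀ v : V, Quiver.Star v ≃ Fin (outdegree v)) (v : V)
    (e : Quiver.Star v) :
    cyclicNetwork.edgeLoad (r := threshold s)
      (fun v e z => if v ≠ s ∧ z.val = (ord v e : ℕ) then [()] else []) v e =
        if v = s then 0 else 1 := by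
  rw [cyclicNetwork.edgeLoad]
  by_cases hv : v = s
  · simp [hv]
  · have hlt : (ord v e : ℕ) < threshold s v := by
      rw [threshold, if_neg hv]
      exact (ord v e).2
    have hval (z : ZMod (threshold s v)) : z.val = ord v e ↔ z = (ord v e : ℕ) :=
      ⟨fun h => by rw [← h, ZMod.natCast_zmod_val], fun h => by rw [h, ZMod.val_cast_of_lt hlt]⟩
    simp [hv, hval, apply_ite]

theorem rotor_homotopic_sand [Fintype V] (ord : ∀ v : V, Quiver.Star v ≃ Fin (outdegree v)) :
    AbelianNetwork.Homotopic (rotor s ord) (sand s) :=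
  cyclicNetwork.homotopic (r := threshold s) _ _ fun v e =>
    (edgeLoad_rotor s ord v e).trans (edgeLoad_sand s v e).symm

variable [Finite V]

theorem exists_superharmonic :
    ∃ c : V → ℤ, (∀ v, 0 < c v) ∧
      ∀ v, v ≠ s → ∑ e : Quiver.Star v, c e.1 ≤ outdegree v * (c v - 1) := by
  obtain ⟨ℓ, hℓ⟩ := exists_star_lt_of_isGlobalSink s
  obtain ⟨L, hL⟩ := Finite.exists_le ℓ
  obtain ⟨d, hd⟩ := Finite.exists_le (outdegree (V := V))
  let D : ℤ := 2 * d + 1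
  have hD : 1 ≤ D := by omega
  have hpow (n : ℕ) : 1 ≤ D ^ n := one_le_pow₀ hD
  -- The steep convex function `D ^ (L - ℓ)` of the height makes the one edge that goes down
  -- outweigh all others.
  refine ⟨fun v => D ^ L + 1 - D ^ (L - ℓ v), fun v => ?_, fun v hv => ?_⟩
  · have := pow_le_pow_right₀ hD (Nat.sub_le L (ℓ v))
    dsimp only
    omega
  · obtain ⟨e, he⟩ := hℓ v hv
    have hsum : outdegree v * (D ^ (L - ℓ v) + 1) ≤ ∑ e : Quiver.Star v, D ^ (L - ℓ e.1) :=
      calc outdegree v * (D ^ (L - ℓ v) + 1)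
        _ ≤ d * (2 * D ^ (L - ℓ v)) := by
          gcongr
          · exact hd v
          · linarith [hpow (L - ℓ v)]
        _ ≤ D ^ (L - ℓ v) * D := by linarith [hpow (L - ℓ v)]
        _ = D ^ (L - ℓ v + 1) := (pow_succ _ _).symm
        _ ≤ D ^ (L - ℓ e.1) := pow_le_pow_right₀ hD (by have := hL v; omega)
        _ ≤ ∑ e : Quiver.Star v, D ^ (L - ℓ e.1) :=
          Finset.single_le_sum (f := fun e : Quiver.Star v => D ^ (L - ℓ e.1))
            (fun e _ => zero_le_one.trans (hpow _)) (Finset.mem_univ e)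
    rw [Finset.sum_sub_distrib, Finset.sum_const, Finset.card_univ, nsmul_eq_mul, ← outdegree]
    linarith

open Classical in
theorem cyclicNetwork.haltsOnAllInputs_of_edgeLoad
    {o : ∀ v, Quiver.Star v → ZMod (threshold s v) → List Unit}
    (ho : ∀ v e, edgeLoad o v e = if v = s then 0 else 1) :
    (cyclicNetwork (threshold s) o).HaltsOnAllInputs := by
  obtain ⟨c, hc_pos, hc⟩ := exists_superharmonic s
  refine haltsOnAllInputs o c (fun v => (hc_pos v).le) fun v => ?_
  simp only [ho]
  split_ifs with hv
  · simp only [Nat.cast_zero, mul_zero, Finset.sum_const_zero]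
    exact mul_nonneg (Int.natCast_nonneg _) (Int.sub_nonneg_of_le (hc_pos v))
  · simpa only [threshold, if_neg hv, Nat.cast_one, mul_one] using hc v hv

theorem sand_haltsOnAllInputs : (sand s).HaltsOnAllInputs :=
  cyclicNetwork.haltsOnAllInputs_of_edgeLoad s (edgeLoad_sand s)

theorem rotor_haltsOnAllInputs (ord : ∀ v : V, Quiver.Star v ≃ Fin (outdegree v)) :
    (rotor s ord).HaltsOnAllInputs :=
  cyclicNetwork.haltsOnAllInputs_of_edgeLoad s (edgeLoad_rotor s ord)

end Sink

theorem corollary3p13 (V : Type uV) [Quiver.{uE + 1} V] [Fintype V]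
    [∀ v : V, Fintype (Quiver.Star v)] :
    (∀ (A : V → Type uA) [∀ v, Fintype (A v)]
        (N : AbelianNetwork.{uV, uE, uA, uQ} V A) (N' : AbelianNetwork.{uV, uE, uA, uQ'} V A)
        [∀ v, Finite (N.Q v)] [∀ v, Finite (N'.Q v)]
        (h : N.HaltsOnAllInputs) (h' : N'.HaltsOnAllInputs),
        AbelianNetwork.Homotopic N N' →
          Nonempty (AbelianNetwork.Crit h ≃* AbelianNetwork.Crit h')) ∧
    (∀ (s : V) [IsGlobalSink s] (ord : ∀ v : V, Quiver.Star v ≃ Fin (outdegree v)),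
        AbelianNetwork.Homotopic (rotor s ord) (sand s) ∧
        ∃ (hR : (rotor s ord).HaltsOnAllInputs) (hS : (sand s).HaltsOnAllInputs),
          Nonempty (AbelianNetwork.Crit hR ≃* AbelianNetwork.Crit hS)) := by
  refine ⟨fun A _ N N' _ _ h h' H => H.nonempty_crit_mulEquiv h h', fun s _ ord => ?_⟩
  exact ⟨rotor_homotopic_sand s ord, rotor_haltsOnAllInputs s ord, sand_haltsOnAllInputs s,
    (rotor_homotopic_sand s ord).nonempty_crit_mulEquiv _ _⟩
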